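/- For points $F_1,F_2$ of the Euclidean plane and a real $s>|F_1F_2|$ let $E_s(F_1,F_2)=\{p:|pF_1|+|pF_2|=s\}$ be the ellipse with foci $F_1,F_2$ (a circle if $F_1=F_2$); ellipses with the same foci are called confocal. A line is tangent to an ellipse if it meets it in exactly one point. Let $n\ge 1$. (a) A billiard trajectory in an ellipse $\Gamma$ is a sequence of points $x_0,x_1,x_2,\dots$ of $\Gamma$ with $x_{i+1}\ne x_i$ such that, for every $i\ge 0$, the direction of $x_{i+2}-x_{i+1}$ is the mirror image of the direction of $x_{i+1}-x_i$ in the tangent line of $\Gamma$ at $x_{i+1}$. It is tangent to an ellipse $\gamma$ confocal to $\Gamma$ if one of the lines $x_ix_{i+1}$ is tangent to $\gamma$ (all of them are then tangent to $\gamma$), and it is $n$-periodic if $x_{i+n}=x_i$ for all $i$. Let $\Gamma$ and $\gamma$ be confocal ellipses. If some billiard trajectory in $\Gamma$ tangent to $\gamma$ is $n$-periodic, then every billiard trajectory in $\Gamma$ tangent to $\gamma$ is $n$-periodic. (b) The billiard ball map $T_\Gamma$ of an ellipse $\Gamma$ sends an oriented line $\ell$ that meets $\Gamma$ to the oriented line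 $\ell'$ that passes through the last point $y$ of $\ell$ on $\Gamma$ and whose direction is the mirror image of that of $\ell$ in the tangent line of $\Gamma$ at $y$. Let $\Gamma_1,\dots,\Gamma_k$ and $\gamma$ be confocal ellipses, with $\gamma$ inside every $\Gamma_j$, and let $T=T_{\Gamma_k}\circ\dots\circ T_{\Gamma_1}$. If $T^n\ell=\ell$ for some oriented line $\ell$ tangent to $\gamma$, then $T^n\ell'=\ell'$ for every oriented line $\ell'$ tangent to $\gamma$. (c) (Poncelet porism) Let $\Gamma$ and $\gamma$ be two ellipses, not necessarily confocal, with $\gamma$ contained in the open region bounded by $\Gamma$. Consider sequences $x_0,x_1,x_2,\dots$ of points of $\Gamma$ such that, for every $i\ge 0$, $x_{i+1}\ne x_i$, the line $x_ix_{i+1}$ is tangent to $\gamma$, and $x_{i+2}\ne x_i$. If $x_n=x_0$ for one such sequence $(x_i)$, then every such sequence $(y_i)$ satisfies $y_{i+n}=y_i$ for all $i\ge 0$. -/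

import Mathlib

noncomputable section

/-- The Euclidean plane. -/
abbrev Plane : Type := EuclideanSpace ℝ (Fin 2)

/-- The locus of points whose distances to the foci `F₁`, `F₂` have sum `s`. It is an ellipse when
`dist F₁ F₂ < s`, and a circle when moreover `F₁ = F₂`. Ellipses with the same foci are
confocal. -/
def ellipse (F₁ F₂ : Plane) (s : ℝ) : Set Plane :=
  {p | dist p F₁ + dist p F₂ = s}

/-- The open region bounded by `ellipse F₁ F₂ s`. -/
def ellipseInterior (F₁ F₂ : Plane) (s : ℝ) : Set Plane :=
  {p | dist p F₁ + dist p F₂ < s}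

/-- `L` is a straight line tangent at `y` to the ellipse `E`: it meets `E` at `y` and nowhere
else. -/
def IsTangentAt (E : Set Plane) (L : AffineSubspace ℝ Plane) (y : Plane) : Prop :=
  Module.finrank ℝ L.direction = 1 ∧ (L : Set Plane) ∩ E = {y}

/-- `L` is a straight line tangent to the ellipse `E`. -/
def IsTangent (E : Set Plane) (L : AffineSubspace ℝ Plane) : Prop :=
  ∃ y, IsTangentAt E L y

/-- The law of reflection at the point `y` of `E`: the outgoing direction `w` is that of the mirror
image of the incoming direction `u` in the tangent line of `E` at `y`. -/
def Reflects (E : Set Plane) (y u w : Plane) : Prop :=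
  ∃ L : AffineSubspace ℝ Plane, IsTangentAt E L y ∧ SameRay ℝ (L.direction.reflection u) w

/-- `x 0, x 1, x 2, …` are the successive impact points of a billiard trajectory inside `E`. -/
def IsBilliardTrajectory (E : Set Plane) (x : ℕ → Plane) : Prop :=
  (∀ i, x i ∈ E) ∧ (∀ i, x (i + 1) ≠ x i) ∧
    ∀ i, Reflects E (x (i + 1)) (x (i + 1) - x i) (x (i + 2) - x (i + 1))

/-- The trajectory with impact points `x` has a segment whose line is tangent to `E`. For a
trajectory inside an ellipse confocal to `E`, all segments are then tangent to `E`. -/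
def IsTangentTrajectory (E : Set Plane) (x : ℕ → Plane) : Prop :=
  ∃ i, IsTangent E (AffineSubspace.mk' (x i) (Submodule.span ℝ {x (i + 1) - x i}))

/-- An oriented line of the plane: a line together with a unit vector that directs it. -/
@[ext]
structure OrientedLine where
  line : AffineSubspace ℝ Plane
  dir : Plane
  norm_dir : ‖dir‖ = 1
  line_eq : ∃ p, line = AffineSubspace.mk' p (Submodule.span ℝ {dir})

/-- The billiard in `E` sends the oriented line `ℓ` to `ℓ'`: `ℓ` leaves the table at the point `y`
of `E` (its last point on `E`), and `ℓ'` is the line through `y` into which `ℓ` is reflected. -/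
def BilliardStep (E : Set Plane) (ℓ ℓ' : OrientedLine) : Prop :=
  ∃ y, y ∈ E ∧ y ∈ ℓ.line ∧ (∀ r : ℝ, 0 < r → y + r • ℓ.dir ∉ E) ∧
    y ∈ ℓ'.line ∧ Reflects E y ℓ.dir ℓ'.dir

open Classical in
/-- The billiard ball map of `E` on oriented lines. For an ellipse `E` the line `ℓ'` with
`BilliardStep E ℓ ℓ'` exists and is unique as soon as `ℓ` meets `E`; lines that miss `E` are left
where they are. -/
def billiardMap (E : Set Plane) (ℓ : OrientedLine) : OrientedLine :=
  if h : ∃ ℓ', BilliardStep E ℓ ℓ' then h.choose else ℓ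

/-- The composition of the billiard ball maps of the ellipses with foci `F₁`, `F₂` and distance
sums `s 0, …, s (k - 1)`, that of `s 0` being applied first. -/
def billiardComposition (F₁ F₂ : Plane) {k : ℕ} (s : Fin k → ℝ) : OrientedLine → OrientedLine :=
  (List.ofFn s).foldl (fun f r => billiardMap (ellipse F₁ F₂ r) ∘ f) id

/-- `x 0, x 1, x 2, …` are the successive vertices of a polygonal line inscribed in `E` and
circumscribed about `C`: each side lies on a line tangent to `C`, and from each vertex one
continues along the other tangent line. -/
def IsPonceletLine (E C : Set Plane) (x : ℕ → Plane) : Prop :=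
  (∀ i, x i ∈ E) ∧ (∀ i, x (i + 1) ≠ x i) ∧
    (∀ i, IsTangent C (AffineSubspace.mk' (x i) (Submodule.span ℝ {x (i + 1) - x i}))) ∧
    ∀ i, x (i + 2) ≠ x i

end

open Real

noncomputable section

/-! Poncelet's porism comes from an invariant measure. An affine chart takes the inner ellipse to
the unit circle and the outer one to a conic `q` around it. On the tangent line at angle `φ`, with
signed parameter `r` counted from the point of contact, `q` restricts to a quadratic `A r² + 2 B r +
C` with `A > 0 > C`. Its positive root `τ` is the exit point, and the other tangent from there
touches the circle at `next φ = φ + 2 arctan τ`. Differentiating the equation of `τ` gives `next' =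
√(disc (next φ)) / √(disc φ)` (`Conic.Surrounds.hasDerivAt_next`), so `next` preserves `dφ / √disc`
and is a translation in the coordinate `∫ dφ / √disc`.

Iterates of a translation are translations. If one of them fixes a single angle modulo `2π`, it
agrees at that angle with a shift by a multiple of `2π`. That shift is a translation in the same
coordinate, because the density is periodic, so the two agree everywhere
(`IsTranslationFor.sameAngle`). A circumscribed polygonal line keeps its sense of rotation, and its
contact angles follow `next` forwards or backwards; this gives part (c).

For confocal ellipses, the quadratic form that detects tangency to the inner one is invariant under
reflection in the outer one (`IsNested.causticForm_mirror`). A billiard trajectory with one tangent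
segment is therefore a Poncelet line, and (a) follows from (c).

For (b), the discriminants of all confocal outer ellipses, seen from the caustic, are constant
multiples of one function (`disc_confocalConic`). The billiard maps are therefore translations in
one common coordinate, and so is any composition of them. Lines of the opposite orientation are
handled by a mirrored chart, which leads to the same map of angles. -/

/-- The quadratic polynomial `a X² + 2 b X Y + c Y² + 2 d X + 2 e Y + f`. -/
structure Conic where
  a : ℝ
  b : ℝ
  c : ℝ
  d : ℝ
  e : ℝ
  f : ℝ

/-! ### A conic along the tangent lines of the unit circle -/

namespace Conic

/-- The value of the polynomial at `(x, y)`. -/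
def eval (q : Conic) (x y : ℝ) : ℝ :=
  q.a * x ^ 2 + 2 * q.b * x * y + q.c * y ^ 2 + 2 * q.d * x + 2 * q.e * y + q.f

/-- Quadratic coefficient of `q` on the tangent line to the unit circle at angle `φ`. -/
def quadCoeff (q : Conic) (φ : ℝ) : ℝ :=
  q.a * sin φ ^ 2 - 2 * q.b * sin φ * cos φ + q.c * cos φ ^ 2

/-- Half the linear coefficient of `q` on the tangent line to the unit circle at angle `φ`. -/
def linCoeff (q : Conic) (φ : ℝ) : ℝ :=
  -q.a * sin φ * cos φ + q.b * (cos φ ^ 2 - sin φ ^ 2) + q.c * sin φ * cos φ - q.d * sin φ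
    + q.e * cos φ

/-- Constant coefficient of `q` on the tangent line to the unit circle at angle `φ`. -/
def constCoeff (q : Conic) (φ : ℝ) : ℝ := q.eval (cos φ) (sin φ)

/-- Discriminant of `q` on the tangent line to the unit circle at angle `φ`. -/
def disc (q : Conic) (φ : ℝ) : ℝ := q.linCoeff φ ^ 2 - q.quadCoeff φ * q.constCoeff φ

theorem eval_tangent (q : Conic) (φ r : ℝ) :
    q.eval (cos φ - r * sin φ) (sin φ + r * cos φ) =
      q.quadCoeff φ * r ^ 2 + 2 * q.linCoeff φ * r + q.constCoeff φ := by
  simp only [eval, quadCoeff, linCoeff, constCoeff]; ring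

/-- The conic `q = 0` is an ellipse with the unit circle in its interior. -/
structure Surrounds (q : Conic) : Prop where
  quad_pos : ∀ φ, 0 < q.quadCoeff φ
  const_neg : ∀ φ, q.constCoeff φ < 0

/-- The positive parameter at which the tangent line at angle `φ` meets the conic. -/
def exitTime (q : Conic) (φ : ℝ) : ℝ := (-q.linCoeff φ + √(q.disc φ)) / q.quadCoeff φ

/-- The angle of the point of contact of the other tangent line through the point where the
tangent line at angle `φ` leaves the conic. -/
def next (q : Conic) (φ : ℝ) : ℝ := φ + 2 * arctan (q.exitTime φ)

namespace Surrounds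

variable {q : Conic} (h : q.Surrounds) (φ : ℝ)
include h

theorem disc_pos : 0 < q.disc φ := by
  have h1 := mul_pos (h.quad_pos φ) (neg_pos.2 (h.const_neg φ))
  unfold disc
  nlinarith [sq_nonneg (q.linCoeff φ)]

theorem quad_mul_exitTime_add : q.quadCoeff φ * q.exitTime φ + q.linCoeff φ = √(q.disc φ) := by
  have := (h.quad_pos φ).ne'
  unfold exitTime; field_simp; ring

theorem exitTime_eq_zero :
    q.quadCoeff φ * q.exitTime φ ^ 2 + 2 * q.linCoeff φ * q.exitTime φ + q.constCoeff φ = 0 := by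
  have h1 := h.quad_mul_exitTime_add φ
  have h2 := Real.sq_sqrt (h.disc_pos φ).le
  rw [← h1, disc] at h2
  have h3 := (h.quad_pos φ).ne'
  apply mul_left_cancel₀ h3
  linear_combination h2

theorem exitTime_pos : 0 < q.exitTime φ := by
  apply div_pos _ (h.quad_pos φ)
  have : |q.linCoeff φ| < √(q.disc φ) := by
    rw [← Real.sqrt_sq_eq_abs]
    apply Real.sqrt_lt_sqrt (sq_nonneg _)
    have h1 := mul_pos (h.quad_pos φ) (neg_pos.2 (h.const_neg φ))
    unfold disc
    linarith
  linarith [le_abs_self (q.linCoeff φ)]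

/-- The product of the two roots has the sign of `constCoeff / quadCoeff`, which is negative, so
there is only one root of each sign. -/
theorem exitTime_unique {r : ℝ} (hr : 0 < r)
    (h0 : q.quadCoeff φ * r ^ 2 + 2 * q.linCoeff φ * r + q.constCoeff φ = 0) :
    r = q.exitTime φ := by
  have h1 := h.exitTime_eq_zero φ
  have h2 := h.exitTime_pos φ
  -- Eliminating the linear coefficient between the two equations leaves the factor `r - q.exitTime
  -- φ`.
  have h3 : (r - q.exitTime φ) * (q.quadCoeff φ * r * q.exitTime φ - q.constCoeff φ) = 0 := by
    linear_combination q.exitTime φ * h0 - r * h1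
  rcases mul_eq_zero.1 h3 with h4 | h4
  · linarith
  · have := mul_pos (mul_pos (h.quad_pos φ) hr) h2
    linarith [h.const_neg φ]

theorem eq_of_neg_root {r r' : ℝ} (hr : r < 0) (hr' : r' < 0)
    (h0 : q.quadCoeff φ * r ^ 2 + 2 * q.linCoeff φ * r + q.constCoeff φ = 0)
    (h1 : q.quadCoeff φ * r' ^ 2 + 2 * q.linCoeff φ * r' + q.constCoeff φ = 0) : r = r' := by
  have h3 : (r - r') * (q.quadCoeff φ * (r * r') - q.constCoeff φ) = 0 := by
    linear_combination r' * h0 - r * h1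
  rcases mul_eq_zero.1 h3 with h4 | h4
  · linarith
  · have := mul_pos (h.quad_pos φ) (mul_pos_of_neg_of_neg hr hr')
    linarith [h.const_neg φ]

theorem root_ne_zero {r : ℝ}
    (h0 : q.quadCoeff φ * r ^ 2 + 2 * q.linCoeff φ * r + q.constCoeff φ = 0) : r ≠ 0 := by
  rintro rfl
  have := h.const_neg φ
  linarith

theorem neg_root_eq {r : ℝ} (hr : r < 0)
    (h0 : q.quadCoeff φ * r ^ 2 + 2 * q.linCoeff φ * r + q.constCoeff φ = 0) :
    q.quadCoeff φ * r + q.linCoeff φ = -√(q.disc φ) := by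
  have h2 : (q.quadCoeff φ * r + q.linCoeff φ) ^ 2 = √(q.disc φ) ^ 2 := by
    rw [Real.sq_sqrt (h.disc_pos φ).le, disc]
    linear_combination q.quadCoeff φ * h0
  rcases sq_eq_sq_iff_eq_or_eq_neg.1 h2 with h3 | h3
  · exfalso
    have h4 := h.quad_mul_exitTime_add φ
    have h5 : q.quadCoeff φ * (r - q.exitTime φ) = 0 := by linear_combination h3 - h4
    rcases mul_eq_zero.1 h5 with h6 | h6
    · exact (h.quad_pos φ).ne' h6
    · linarith [h.exitTime_pos φ]
  · exact h3

end Surrounds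

/-! ### The map `next` and its derivative -/

theorem cos_two_arctan (t : ℝ) : cos (2 * arctan t) = (1 - t ^ 2) / (1 + t ^ 2) := by
  have : 1 + t ^ 2 ≠ 0 := by positivity
  rw [Real.cos_two_mul, Real.cos_sq_arctan]; field_simp; ring

theorem sin_two_arctan (t : ℝ) : sin (2 * arctan t) = 2 * t / (1 + t ^ 2) := by
  have h : 0 < 1 + t ^ 2 := by positivity
  rw [Real.sin_two_mul, Real.sin_arctan, Real.cos_arctan]
  have := Real.mul_self_sqrt h.le
  have h2 : √(1 + t ^ 2) ≠ 0 := by positivity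
  field_simp
  linear_combination -t * this

theorem cos_next (q : Conic) (φ : ℝ) : cos (q.next φ) * (1 + q.exitTime φ ^ 2) =
    cos φ * (1 - q.exitTime φ ^ 2) - sin φ * (2 * q.exitTime φ) := by
  have h : 1 + q.exitTime φ ^ 2 ≠ 0 := by positivity
  rw [next, cos_add, cos_two_arctan, sin_two_arctan]; field_simp

theorem sin_next (q : Conic) (φ : ℝ) : sin (q.next φ) * (1 + q.exitTime φ ^ 2) =
    sin φ * (1 - q.exitTime φ ^ 2) + cos φ * (2 * q.exitTime φ) := by
  have h : 1 + q.exitTime φ ^ 2 ≠ 0 := by positivity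
  rw [next, sin_add, cos_two_arctan, sin_two_arctan]; field_simp

/-- The two tangents from an exterior point to a circle are equally long: the exit point has
parameter `exitTime` on the old tangent and `-exitTime` on the new one. -/
theorem exit_fst (q : Conic) (φ : ℝ) : cos (q.next φ) + q.exitTime φ * sin (q.next φ) =
    cos φ - q.exitTime φ * sin φ := by
  have h : 1 + q.exitTime φ ^ 2 ≠ 0 := by positivity
  apply mul_left_cancel₀ h
  linear_combination q.cos_next φ + q.exitTime φ * q.sin_next φ

theorem exit_snd (q : Conic) (φ : ℝ) : sin (q.next φ) - q.exitTime φ * cos (q.next φ) =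
    sin φ + q.exitTime φ * cos φ := by
  have h : 1 + q.exitTime φ ^ 2 ≠ 0 := by positivity
  apply mul_left_cancel₀ h
  linear_combination q.sin_next φ - q.exitTime φ * q.cos_next φ

theorem Surrounds.neg_exitTime_eq_zero {q : Conic} (h : q.Surrounds) (φ : ℝ) :
    q.quadCoeff (q.next φ) * (-q.exitTime φ) ^ 2 + 2 * q.linCoeff (q.next φ) * (-q.exitTime φ)
      + q.constCoeff (q.next φ) = 0 := by
  have h1 := q.exit_fst φ
  have h2 := q.exit_snd φ
  rw [← eval_tangent]
  have e1 : cos (q.next φ) - -q.exitTime φ * sin (q.next φ) = cos φ - q.exitTime φ * sin φ := by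
    linarith
  have e2 : sin (q.next φ) + -q.exitTime φ * cos (q.next φ) = sin φ + q.exitTime φ * cos φ := by
    linarith
  rw [e1, e2, eval_tangent, h.exitTime_eq_zero]

/-- The exit point of the old tangent is the negative root on the new one, so the square root at
`next φ` becomes rational in `exitTime φ`. -/
theorem Surrounds.sqrt_disc_next {q : Conic} (h : q.Surrounds) (φ : ℝ) :
    √(q.disc (q.next φ)) =
      q.quadCoeff (q.next φ) * q.exitTime φ - q.linCoeff (q.next φ) := by
  have := h.neg_root_eq (q.next φ) (neg_lt_zero.2 (h.exitTime_pos φ)) (h.neg_exitTime_eq_zero φ)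
  linarith

theorem hasDerivAt_quadCoeff (q : Conic) (φ : ℝ) : HasDerivAt q.quadCoeff
    (2 * (q.a * sin φ * cos φ - q.b * (cos φ ^ 2 - sin φ ^ 2) - q.c * sin φ * cos φ)) φ := by
  have hs := hasDerivAt_sin φ
  have hc := hasDerivAt_cos φ
  have := (((hs.pow 2).const_mul q.a).sub ((hs.mul hc).const_mul (2 * q.b))).add
    ((hc.pow 2).const_mul q.c)
  refine (this.congr_deriv ?_).congr_of_eventuallyEq (.of_forall fun x => ?_)
  · push_cast; ring
  · simp only [quadCoeff]; simp; ring

theorem hasDerivAt_linCoeff (q : Conic) (φ : ℝ) : HasDerivAt q.linCoeff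
    (q.quadCoeff φ - q.eval (cos φ) (sin φ) + q.d * cos φ + q.e * sin φ + q.f) φ := by
  have hs := hasDerivAt_sin φ
  have hc := hasDerivAt_cos φ
  have := ((((hs.mul hc).const_mul (q.c - q.a)).add (((hc.pow 2).sub (hs.pow 2)).const_mul q.b)).sub
    (hs.const_mul q.d)).add (hc.const_mul q.e)
  refine (this.congr_deriv ?_).congr_of_eventuallyEq (.of_forall fun x => ?_)
  · simp only [quadCoeff, eval]; push_cast; ring
  · simp only [linCoeff]; simp; ring

/-- The velocity on the circle is the direction of the tangent line, so this derivative is the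
linear term along that line. -/
theorem hasDerivAt_constCoeff (q : Conic) (φ : ℝ) :
    HasDerivAt q.constCoeff (2 * q.linCoeff φ) φ := by
  have hs := hasDerivAt_sin φ
  have hc := hasDerivAt_cos φ
  have := ((((((hc.pow 2).const_mul q.a).add ((hc.mul hs).const_mul (2 * q.b))).add
    ((hs.pow 2).const_mul q.c)).add (hc.const_mul (2 * q.d))).add
    (hs.const_mul (2 * q.e))).add_const q.f
  refine (this.congr_deriv ?_).congr_of_eventuallyEq (.of_forall fun x => ?_)
  · simp only [linCoeff]; push_cast; ring
  · simp only [constCoeff, eval]; simp; ring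

theorem Surrounds.differentiableAt_exitTime {q : Conic} (h : q.Surrounds) (φ : ℝ) :
    DifferentiableAt ℝ q.exitTime φ := by
  have hA := (q.hasDerivAt_quadCoeff φ).differentiableAt
  have hB := (q.hasDerivAt_linCoeff φ).differentiableAt
  have hC := (q.hasDerivAt_constCoeff φ).differentiableAt
  have hD : DifferentiableAt ℝ q.disc φ := (hB.pow 2).sub (hA.mul hC)
  exact (hB.neg.add (hD.sqrt (h.disc_pos φ).ne')).div hA (h.quad_pos φ).ne'

/-- The invariance of the measure `dφ / √disc`, from which the porism follows. -/
theorem Surrounds.hasDerivAt_next {q : Conic} (h : q.Surrounds) (φ : ℝ) :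
    HasDerivAt q.next (√(q.disc (q.next φ)) / √(q.disc φ)) φ := by
  have ht := (h.differentiableAt_exitTime φ).hasDerivAt
  have hA := q.hasDerivAt_quadCoeff φ
  have hB := q.hasDerivAt_linCoeff φ
  have hC := q.hasDerivAt_constCoeff φ
  have hz := ((hA.mul (ht.pow 2)).add ((hB.mul ht).const_mul 2)).add hC
  have hz' : HasDerivAt (fun _ : ℝ => (0 : ℝ)) 0 φ := hasDerivAt_const φ 0
  -- The exit equation holds identically in `φ`, so its derivative is zero; this is a linear
  -- equation for the derivative of `exitTime`.
  have he := hz.unique (hz'.congr_of_eventuallyEq (Filter.Eventually.of_forall fun x => by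
    simpa [mul_assoc] using h.exitTime_eq_zero x))
  have hn : HasDerivAt q.next _ φ := (hasDerivAt_id φ).add (ht.arctan.const_mul 2)
  refine hn.congr_deriv ?_
  have hS : 0 < √(q.disc φ) := Real.sqrt_pos.2 (h.disc_pos φ)
  have hp : 1 + q.exitTime φ ^ 2 ≠ 0 := by positivity
  rw [eq_div_iff hS.ne']
  have h1 := h.quad_mul_exitTime_add φ
  have h2 := h.sqrt_disc_next φ
  have h3 := h.exitTime_eq_zero φ
  have hc := q.cos_next φ
  have hs := q.sin_next φ
  -- Both square roots are now linear in `exitTime φ`. What remains is a rational identity in it,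
  -- its derivative, `cos φ` and `sin φ`.
  rw [h2, ← h1]
  simp only [Pi.pow_apply] at he
  generalize deriv q.exitTime φ = t' at *
  generalize q.exitTime φ = t at *
  have hc' : cos (q.next φ) = (cos φ * (1 - t ^ 2) - sin φ * (2 * t)) / (1 + t ^ 2) := by
    field_simp; linarith
  have hs' : sin (q.next φ) = (sin φ * (1 - t ^ 2) + cos φ * (2 * t)) / (1 + t ^ 2) := by
    field_simp; linarith
  have hcs := Real.sin_sq_add_cos_sq φ
  simp only [quadCoeff, linCoeff, constCoeff, eval] at *
  rw [hc', hs']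
  field_simp
  linear_combination (1 + t ^ 2) * he

end Conic

/-! ### Maps that become translations in a suitable coordinate -/

/-- The primitive of `1 / w` that vanishes at the origin. -/
def invPrimitive (w : ℝ → ℝ) (φ : ℝ) : ℝ := ∫ x in (0 : ℝ)..φ, (w x)⁻¹

/-- `f` becomes a translation in the coordinate `invPrimitive w`. -/
def IsTranslationFor (w f : ℝ → ℝ) : Prop :=
  ∃ c, ∀ φ, invPrimitive w (f φ) = invPrimitive w φ + c

theorem hasDerivAt_invPrimitive {w : ℝ → ℝ} (hw : Continuous w) (hpos : ∀ φ, 0 < w φ) (φ : ℝ) :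
    HasDerivAt (invPrimitive w) (w φ)⁻¹ φ := by
  have hc : Continuous fun x => (w x)⁻¹ := hw.inv₀ fun x => (hpos x).ne'
  exact intervalIntegral.integral_hasDerivAt_right (hc.intervalIntegrable _ _)
    hc.aestronglyMeasurable.stronglyMeasurableAtFilter hc.continuousAt

theorem strictMono_invPrimitive {w : ℝ → ℝ} (hw : Continuous w) (hpos : ∀ φ, 0 < w φ) :
    StrictMono (invPrimitive w) :=
  strictMono_of_deriv_pos fun φ => by
    rw [(hasDerivAt_invPrimitive hw hpos φ).deriv]; exact inv_pos.2 (hpos φ)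

/-- The hypothesis on `f'` says that `f` preserves `dφ / w`, so `invPrimitive w ∘ f - invPrimitive
w` has derivative zero. -/
theorem isTranslationFor_of_hasDerivAt {w f : ℝ → ℝ} (hw : Continuous w) (hpos : ∀ φ, 0 < w φ)
    (hf : ∀ φ, HasDerivAt f (w (f φ) / w φ) φ) : IsTranslationFor w f := by
  have hd : ∀ φ, HasDerivAt (fun x => invPrimitive w (f x) - invPrimitive w x) 0 φ := fun φ => by
    refine (((hasDerivAt_invPrimitive hw hpos (f φ)).comp φ (hf φ)).sub
      (hasDerivAt_invPrimitive hw hpos φ)).congr_deriv ?_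
    have h1 := (hpos φ).ne'
    have h2 := (hpos (f φ)).ne'
    field_simp; simp
  refine ⟨invPrimitive w (f 0) - invPrimitive w 0, fun φ => ?_⟩
  have := is_const_of_deriv_eq_zero (fun x => (hd x).differentiableAt) (fun x => (hd x).deriv) φ 0
  linarith

theorem isTranslationFor_add {w : ℝ → ℝ} (hw : Continuous w) (hpos : ∀ φ, 0 < w φ) {p : ℝ}
    (hp : ∀ φ, w (φ + p) = w φ) : IsTranslationFor w (· + p) :=
  isTranslationFor_of_hasDerivAt hw hpos fun φ => by
    rw [hp, div_self (hpos φ).ne']; exact (hasDerivAt_id φ).add_const p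

namespace IsTranslationFor

theorem id (w : ℝ → ℝ) : IsTranslationFor w id := ⟨0, fun φ => by simp⟩

theorem comp {w f g : ℝ → ℝ} (hf : IsTranslationFor w f) (hg : IsTranslationFor w g) :
    IsTranslationFor w (f ∘ g) := by
  obtain ⟨c, hc⟩ := hf
  obtain ⟨d, hd⟩ := hg
  exact ⟨d + c, fun φ => by rw [Function.comp, hc, hd, add_assoc]⟩

theorem iterate {w f : ℝ → ℝ} (hf : IsTranslationFor w f) (n : ℕ) :
    IsTranslationFor w f^[n] := by
  induction n with
  | zero => exact id w
  | succ n ih => rw [Function.iterate_succ']; exact hf.comp ih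

/-- One common value forces equal translation constants, and the coordinate is injective. -/
theorem eq_of_eq {w f g : ℝ → ℝ} (hw : Continuous w) (hpos : ∀ φ, 0 < w φ)
    (hf : IsTranslationFor w f) (hg : IsTranslationFor w g) {φ₀ : ℝ} (h : f φ₀ = g φ₀) (φ : ℝ) :
    f φ = g φ := by
  obtain ⟨c, hc⟩ := hf
  obtain ⟨d, hd⟩ := hg
  apply (strictMono_invPrimitive hw hpos).injective
  rw [hc, hd]
  have := hc φ₀
  rw [h, hd] at this
  linarith

end IsTranslationFor

/-! ### Angles modulo `2π` -/

/-- Two angles that give the same point of the unit circle. -/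
def SameAngle (φ ψ : ℝ) : Prop := cos φ = cos ψ ∧ sin φ = sin ψ

theorem SameAngle.exists_int {φ ψ : ℝ} (h : SameAngle φ ψ) : ∃ m : ℤ, φ = ψ + m * (2 * π) := by
  have := Real.Angle.cos_sin_inj h.1 h.2
  obtain ⟨m, hm⟩ := Real.Angle.angle_eq_iff_two_pi_dvd_sub.1 this
  exact ⟨m, by linarith⟩

theorem SameAngle.symm {φ ψ : ℝ} (h : SameAngle φ ψ) : SameAngle ψ φ := ⟨h.1.symm, h.2.symm⟩

theorem SameAngle.trans {φ ψ χ : ℝ} (h : SameAngle φ ψ) (h' : SameAngle ψ χ) : SameAngle φ χ :=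
  ⟨h.1.trans h'.1, h.2.trans h'.2⟩

theorem sameAngle_add_int (φ : ℝ) (m : ℤ) : SameAngle (φ + m * (2 * π)) φ :=
  ⟨Real.cos_add_int_mul_two_pi φ m, Real.sin_add_int_mul_two_pi φ m⟩

/-- A map of the circle that is a translation in a suitable coordinate is the identity as soon as
it has a fixed point. -/
theorem IsTranslationFor.sameAngle {w f : ℝ → ℝ} (hw : Continuous w) (hpos : ∀ φ, 0 < w φ)
    (hper : ∀ φ ψ, SameAngle φ ψ → w φ = w ψ) (hf : IsTranslationFor w f) {φ₀ : ℝ}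
    (h : SameAngle (f φ₀) φ₀) (φ : ℝ) : SameAngle (f φ) φ := by
  obtain ⟨m, hm⟩ := h.exists_int
  -- At `φ₀` the map `f` agrees with the shift by `m * (2 * π)`, which is a translation in the same
  -- coordinate since `w` is periodic.
  have := hf.eq_of_eq hw hpos
    (isTranslationFor_add hw hpos fun φ => hper _ _ (sameAngle_add_int φ m)) hm φ
  rw [this]
  exact sameAngle_add_int φ m

/-! ### The porism for contact angles -/

namespace Conic

theorem disc_congr (q : Conic) {φ ψ : ℝ} (h : SameAngle φ ψ) : q.disc φ = q.disc ψ := by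
  simp only [disc, quadCoeff, linCoeff, constCoeff, h.1, h.2]

theorem exitTime_congr (q : Conic) {φ ψ : ℝ} (h : SameAngle φ ψ) :
    q.exitTime φ = q.exitTime ψ := by
  simp only [exitTime, disc, quadCoeff, linCoeff, constCoeff, h.1, h.2]

theorem next_congr (q : Conic) {φ ψ : ℝ} (h : SameAngle φ ψ) :
    SameAngle (q.next φ) (q.next ψ) := by
  simp only [next, SameAngle, cos_add, sin_add, q.exitTime_congr h, h.1, h.2, and_self]

theorem continuous_disc (q : Conic) : Continuous q.disc := by
  unfold disc quadCoeff linCoeff constCoeff eval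
  fun_prop

theorem Surrounds.isTranslationFor {q : Conic} (h : q.Surrounds) :
    IsTranslationFor (fun φ => √(q.disc φ)) q.next :=
  isTranslationFor_of_hasDerivAt q.continuous_disc.sqrt (fun φ => Real.sqrt_pos.2 (h.disc_pos φ))
    h.hasDerivAt_next

theorem Surrounds.iterate_next_sameAngle {q : Conic} (h : q.Surrounds) {n : ℕ} {φ₀ : ℝ}
    (h₀ : SameAngle (q.next^[n] φ₀) φ₀) (φ : ℝ) : SameAngle (q.next^[n] φ) φ :=
  (h.isTranslationFor.iterate n).sameAngle q.continuous_disc.sqrt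
    (fun φ => Real.sqrt_pos.2 (h.disc_pos φ)) (fun _ _ h' => by simp only [q.disc_congr h']) h₀ φ

theorem iterate_next_congr (q : Conic) {φ ψ : ℝ} (h : SameAngle φ ψ) (n : ℕ) :
    SameAngle (q.next^[n] φ) (q.next^[n] ψ) := by
  induction n with
  | zero => exact h
  | succ n ih => simp only [Function.iterate_succ_apply']; exact q.next_congr ih

end Conic

/-! ### Inscribed-circumscribed polygonal lines around the unit circle -/

/-- The point with parameter `r` on the tangent line to the unit circle at angle `φ`. -/
def tangentPoint (φ r : ℝ) : ℝ × ℝ := (cos φ - r * sin φ, sin φ + r * cos φ)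

theorem tangentPoint_sq (φ r : ℝ) :
    (tangentPoint φ r).1 ^ 2 + (tangentPoint φ r).2 ^ 2 = 1 + r ^ 2 := by
  simp only [tangentPoint]
  linear_combination (1 + r ^ 2) * Real.sin_sq_add_cos_sq φ

theorem sameAngle_of_tangentPoint_eq {φ ψ r : ℝ} (h : tangentPoint φ r = tangentPoint ψ r) :
    SameAngle φ ψ := by
  have h1 := congrArg Prod.fst h
  have h2 := congrArg Prod.snd h
  simp only [tangentPoint] at h1 h2
  have hp : 1 + r ^ 2 ≠ 0 := by positivity
  constructor <;> apply mul_left_cancel₀ hp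
  · linear_combination h1 + r * h2
  · linear_combination h2 - r * h1

theorem param_sq_eq_of_tangentPoint_eq {φ ψ r r' : ℝ}
    (h : tangentPoint φ r = tangentPoint ψ r') : r ^ 2 = r' ^ 2 := by
  have h1 := tangentPoint_sq φ r
  rw [h, tangentPoint_sq] at h1
  linarith

theorem tangentPoint_congr {φ ψ : ℝ} (h : SameAngle φ ψ) (r : ℝ) :
    tangentPoint φ r = tangentPoint ψ r := by
  simp only [tangentPoint, h.1, h.2]

theorem Conic.tangentPoint_next (q : Conic) (φ : ℝ) :
    tangentPoint (q.next φ) (-q.exitTime φ) = tangentPoint φ (q.exitTime φ) := by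
  ext
  · simp only [tangentPoint]; linarith [q.exit_fst φ]
  · simp only [tangentPoint]; linarith [q.exit_snd φ]

/-- `z 0, z 1, …` lie on the conic `q`, and the side from `z i` to `z (i + 1)` touches the unit
circle at the angle `φ i`, the vertices having the parameters `a i` and `b i` on that side. -/
structure IsCircumscribed (q : Conic) (z : ℕ → ℝ × ℝ) (φ a b : ℕ → ℝ) : Prop where
  eval : ∀ i, q.eval (z i).1 (z i).2 = 0
  start_eq : ∀ i, z i = tangentPoint (φ i) (a i)
  finish_eq : ∀ i, z (i + 1) = tangentPoint (φ i) (b i)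
  ne : ∀ i, z (i + 1) ≠ z i
  turn : ∀ i, z (i + 2) ≠ z i

namespace IsCircumscribed

variable {q : Conic} {z : ℕ → ℝ × ℝ} {φ a b : ℕ → ℝ}

theorem start_root (H : IsCircumscribed q z φ a b) (i : ℕ) :
    q.quadCoeff (φ i) * a i ^ 2 + 2 * q.linCoeff (φ i) * a i + q.constCoeff (φ i) = 0 := by
  have := H.eval i
  rwa [H.start_eq i, tangentPoint, q.eval_tangent] at this

theorem finish_root (H : IsCircumscribed q z φ a b) (i : ℕ) :
    q.quadCoeff (φ i) * b i ^ 2 + 2 * q.linCoeff (φ i) * b i + q.constCoeff (φ i) = 0 := by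
  have := H.eval (i + 1)
  rwa [H.finish_eq i, tangentPoint, q.eval_tangent] at this

theorem start_ne_finish (H : IsCircumscribed q z φ a b) (i : ℕ) : a i ≠ b i := fun h =>
  H.ne i (by rw [H.finish_eq, H.start_eq, h])

/-- The two ends of a side are distinct roots of the same quadratic, and its roots have opposite
signs. -/
theorem finish_pos_iff (h : q.Surrounds) (H : IsCircumscribed q z φ a b) (i : ℕ) :
    0 < b i ↔ a i < 0 := by
  have ha := H.start_root i
  have hb := H.finish_root i
  have hne := H.start_ne_finish i
  constructor
  · intro hp
    refine lt_of_not_ge fun h' => hne ?_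
    have := lt_of_le_of_ne h' (h.root_ne_zero _ ha).symm
    rw [h.exitTime_unique _ this ha, h.exitTime_unique _ hp hb]
  · intro hp
    refine lt_of_not_ge fun h' => hne ?_
    exact h.eq_of_neg_root _ hp (lt_of_le_of_ne h' (h.root_ne_zero _ hb)) ha hb

/-- The tangent lengths at a common vertex agree up to sign. Equal signs would make both sides lie
on the same tangent, and the next vertex would be `z i` again, which `turn` forbids. -/
theorem start_succ (h : q.Surrounds) (H : IsCircumscribed q z φ a b) (i : ℕ) :
    a (i + 1) = -b i := by
  have heq : tangentPoint (φ (i + 1)) (a (i + 1)) = tangentPoint (φ i) (b i) := by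
    rw [← H.start_eq, ← H.finish_eq]
  rcases sq_eq_sq_iff_eq_or_eq_neg.1 (param_sq_eq_of_tangentPoint_eq heq) with h1 | h1
  · exfalso
    rw [h1] at heq
    have hs := sameAngle_of_tangentPoint_eq heq
    apply H.turn i
    rw [H.finish_eq (i + 1), H.start_eq i, tangentPoint_congr hs]
    congr 1
    have ha := H.start_root i
    have hb : q.quadCoeff (φ i) * b (i + 1) ^ 2 + 2 * q.linCoeff (φ i) * b (i + 1)
        + q.constCoeff (φ i) = 0 := by
      have := H.finish_root (i + 1)
      simp only [Conic.quadCoeff, Conic.linCoeff, Conic.constCoeff, hs.1, hs.2] at this ⊢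
      exact this
    have e1 := H.finish_pos_iff h i
    have e2 := H.finish_pos_iff h (i + 1)
    rw [h1] at e2
    rcases lt_or_gt_of_ne (h.root_ne_zero _ (H.finish_root i)) with h3 | h3
    · have h4 := e2.2 h3
      have h5 : 0 < a i := by
        refine lt_of_le_of_ne (le_of_not_gt fun h' => ?_) (h.root_ne_zero _ ha).symm
        linarith [e1.2 h']
      rw [h.exitTime_unique _ h4 hb, h.exitTime_unique _ h5 ha]
    · have h4 := e1.1 h3
      have h5 : b (i + 1) < 0 := by
        refine lt_of_le_of_ne (le_of_not_gt fun h' => ?_) (h.root_ne_zero _ hb)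
        linarith [e2.1 h']
      exact h.eq_of_neg_root _ h5 h4 hb ha
  · exact h1

/-- The sign of `b` is the sense in which the line runs around the circle; it never changes. -/
theorem finish_pos_succ (h : q.Surrounds) (H : IsCircumscribed q z φ a b) (i : ℕ) :
    0 < b (i + 1) ↔ 0 < b i := by
  rw [H.finish_pos_iff h (i + 1), H.start_succ h]; simp

theorem finish_pos_all (h : q.Surrounds) (H : IsCircumscribed q z φ a b) (i : ℕ) :
    0 < b i ↔ 0 < b 0 := by
  induction i with
  | zero => rfl
  | succ i ih => rw [H.finish_pos_succ h, ih]

theorem finish_eq_exitTime (h : q.Surrounds) (H : IsCircumscribed q z φ a b) (i : ℕ)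
    (hi : 0 < b i) : b i = q.exitTime (φ i) := h.exitTime_unique _ hi (H.finish_root i)

theorem start_pos_of_not (h : q.Surrounds) (H : IsCircumscribed q z φ a b) (i : ℕ)
    (hi : ¬ 0 < b i) : 0 < a i := by
  rw [H.finish_pos_iff h] at hi
  exact lt_of_le_of_ne (not_lt.1 hi) (h.root_ne_zero _ (H.start_root i)).symm

theorem start_eq_exitTime (h : q.Surrounds) (H : IsCircumscribed q z φ a b) (i : ℕ)
    (hi : ¬ 0 < b i) : a i = q.exitTime (φ i) :=
  h.exitTime_unique _ (H.start_pos_of_not h i hi) (H.start_root i)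

theorem sameAngle_succ (h : q.Surrounds) (H : IsCircumscribed q z φ a b) (hb : 0 < b 0) (i : ℕ) :
    SameAngle (φ (i + 1)) (q.next (φ i)) := by
  have hi := (H.finish_pos_all h i).2 hb
  have heq : tangentPoint (φ (i + 1)) (a (i + 1)) = tangentPoint (φ i) (b i) := by
    rw [← H.start_eq, ← H.finish_eq]
  rw [H.start_succ h, H.finish_eq_exitTime h i hi, ← q.tangentPoint_next] at heq
  exact sameAngle_of_tangentPoint_eq heq

/-- A line running clockwise follows `next` when read backwards. -/
theorem sameAngle_pred (h : q.Surrounds) (H : IsCircumscribed q z φ a b) (hb : ¬ 0 < b 0) (i : ℕ) :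
    SameAngle (φ i) (q.next (φ (i + 1))) := by
  have hi : ¬ 0 < b (i + 1) := fun h' => hb ((H.finish_pos_all h _).1 h')
  have heq : tangentPoint (φ (i + 1)) (a (i + 1)) = tangentPoint (φ i) (b i) := by
    rw [← H.start_eq, ← H.finish_eq]
  have hs : b i = -a (i + 1) := by rw [H.start_succ h, neg_neg]
  rw [hs, H.start_eq_exitTime h _ hi, ← q.tangentPoint_next] at heq
  exact (sameAngle_of_tangentPoint_eq heq).symm

theorem sameAngle_add (h : q.Surrounds) (H : IsCircumscribed q z φ a b) (hb : 0 < b 0) (i n : ℕ) :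
    SameAngle (φ (i + n)) (q.next^[n] (φ i)) := by
  induction n with
  | zero => exact ⟨rfl, rfl⟩
  | succ n ih =>
    rw [Function.iterate_succ_apply']
    exact (H.sameAngle_succ h hb (i + n)).trans (q.next_congr ih)

theorem sameAngle_sub (h : q.Surrounds) (H : IsCircumscribed q z φ a b) (hb : ¬ 0 < b 0)
    (i n : ℕ) : SameAngle (φ i) (q.next^[n] (φ (i + n))) := by
  induction n with
  | zero => exact ⟨rfl, rfl⟩
  | succ n ih =>
    rw [Function.iterate_succ_apply]
    exact ih.trans (q.iterate_next_congr (H.sameAngle_pred h hb (i + n)) n)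

/-- Two tangents pass through a vertex, with opposite parameters; the constant sense of rotation
selects one of them. -/
theorem sameAngle_of_eq (h : q.Surrounds) (H : IsCircumscribed q z φ a b) {i j : ℕ}
    (hij : z i = z j) : SameAngle (φ i) (φ j) := by
  rw [H.start_eq i, H.start_eq j] at hij
  have haa : a i = a j := by
    rcases sq_eq_sq_iff_eq_or_eq_neg.1 (param_sq_eq_of_tangentPoint_eq hij) with h1 | h1
    · exact h1
    · exfalso
      have e1 := H.finish_pos_iff h i
      have e2 := H.finish_pos_iff h j
      rw [H.finish_pos_all h] at e1 e2
      have h0 := h.root_ne_zero _ (H.start_root i)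
      have : a i < 0 ↔ a j < 0 := e1.symm.trans e2
      rcases lt_or_gt_of_ne h0 with h3 | h3
      · linarith [this.1 h3]
      · have := this.2 (by linarith)
        linarith
  rw [haa] at hij
  exact sameAngle_of_tangentPoint_eq hij

theorem eq_of_sameAngle (h : q.Surrounds) (H : IsCircumscribed q z φ a b) {i j : ℕ}
    (hij : SameAngle (φ i) (φ j)) : z i = z j := by
  rw [H.start_eq i, H.start_eq j, tangentPoint_congr hij]
  congr 1
  by_cases hb : 0 < b 0
  · have hi := (H.finish_pos_iff h i).1 ((H.finish_pos_all h i).2 hb)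
    have hj := (H.finish_pos_iff h j).1 ((H.finish_pos_all h j).2 hb)
    have hr := H.start_root i
    simp only [Conic.quadCoeff, Conic.linCoeff, Conic.constCoeff, hij.1, hij.2] at hr
    exact h.eq_of_neg_root (φ j) hi hj hr (H.start_root j)
  · have hi : ¬ 0 < b i := fun h' => hb ((H.finish_pos_all h _).1 h')
    have hj : ¬ 0 < b j := fun h' => hb ((H.finish_pos_all h _).1 h')
    rw [H.start_eq_exitTime h i hi, H.start_eq_exitTime h j hj, q.exitTime_congr hij]

theorem exists_iterate_sameAngle (h : q.Surrounds) (H : IsCircumscribed q z φ a b) {n : ℕ}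
    (hn : z n = z 0) (ψ : ℝ) : SameAngle (q.next^[n] ψ) ψ := by
  have hs := H.sameAngle_of_eq h hn
  by_cases hb : 0 < b 0
  · have := H.sameAngle_add h hb 0 n
    rw [zero_add] at this
    exact h.iterate_next_sameAngle (this.symm.trans hs) ψ
  -- In the clockwise case the angle fixed by the iterate is `φ n`.
  · have := H.sameAngle_sub h hb 0 n
    rw [zero_add] at this
    exact h.iterate_next_sameAngle (this.symm.trans hs.symm) ψ

theorem periodic (h : q.Surrounds) (H : IsCircumscribed q z φ a b) {n : ℕ}
    (hn : ∀ ψ, SameAngle (q.next^[n] ψ) ψ) : Function.Periodic z n := fun i => by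
  apply H.eq_of_sameAngle h
  by_cases hb : 0 < b 0
  · exact (H.sameAngle_add h hb i n).trans (hn _)
  · exact ((H.sameAngle_sub h hb i n).trans (hn _)).symm

end IsCircumscribed

/-! ### Charts that take an ellipse to the unit circle -/

/-- The affine chart `Φ` of the plane takes the unit circle to `E`. -/
def IsUnitChart (Φ : (ℝ × ℝ) ≃ᵃ[ℝ] Plane) (E : Set Plane) : Prop :=
  ∀ z, Φ z ∈ E ↔ z.1 ^ 2 + z.2 ^ 2 = 1

/-- The tangent line at angle `φ`. -/
def chartTangent (Φ : (ℝ × ℝ) ≃ᵃ[ℝ] Plane) (φ : ℝ) : AffineSubspace ℝ Plane :=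
  AffineSubspace.mk' (Φ (cos φ, sin φ)) (Submodule.span ℝ {Φ.linear (-sin φ, cos φ)})

theorem chart_add_smul (Φ : (ℝ × ℝ) ≃ᵃ[ℝ] Plane) (z v : ℝ × ℝ) (r : ℝ) :
    Φ (z + r • v) = Φ z + r • Φ.linear v := by
  rw [add_comm z, ← vadd_eq_add, Φ.map_vadd, map_smul, vadd_eq_add, add_comm]

theorem tangentPoint_eq (φ r : ℝ) :
    tangentPoint φ r = (cos φ, sin φ) + r • (-sin φ, cos φ) := by
  ext <;> simp [tangentPoint]; ring

theorem exists_angle {x y : ℝ} (h : x ^ 2 + y ^ 2 = 1) : ∃ φ, x = cos φ ∧ y = sin φ := by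
  have hn : ‖(⟨x, y⟩ : ℂ)‖ = 1 := by
    rw [Complex.norm_def, Complex.normSq_mk, ← sq, ← sq, h, sqrt_one]
  refine ⟨Complex.arg ⟨x, y⟩, ?_, ?_⟩
  · simpa [hn] using (Complex.norm_mul_cos_arg ⟨x, y⟩).symm
  · simpa [hn] using (Complex.norm_mul_sin_arg ⟨x, y⟩).symm

theorem mem_mk'_span {p v x : Plane} :
    x ∈ AffineSubspace.mk' p (Submodule.span ℝ {v}) ↔ ∃ r : ℝ, x = p + r • v := by
  rw [AffineSubspace.mem_mk', vsub_eq_sub, Submodule.mem_span_singleton]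
  exact exists_congr fun r => ⟨fun h => by rw [h]; abel, fun h => by rw [h]; abel⟩

theorem mem_chartTangent {Φ : (ℝ × ℝ) ≃ᵃ[ℝ] Plane} {φ : ℝ} {x : Plane} :
    x ∈ chartTangent Φ φ ↔ ∃ r, x = Φ (tangentPoint φ r) := by
  simp only [chartTangent, mem_mk'_span, tangentPoint_eq, chart_add_smul]

theorem direction_ne_zero (φ : ℝ) : ((-sin φ, cos φ) : ℝ × ℝ) ≠ 0 := by
  intro h
  have h1 : -sin φ = 0 := congrArg Prod.fst h
  have h2 : cos φ = 0 := congrArg Prod.snd h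
  have := sin_sq_add_cos_sq φ
  nlinarith

theorem chart_linear_ne_zero (Φ : (ℝ × ℝ) ≃ᵃ[ℝ] Plane) {v : ℝ × ℝ} (hv : v ≠ 0) :
    Φ.linear v ≠ 0 := by simpa using hv

theorem isTangentAt_chartTangent {Φ : (ℝ × ℝ) ≃ᵃ[ℝ] Plane} {E : Set Plane}
    (hΦ : IsUnitChart Φ E) (φ : ℝ) :
    IsTangentAt E (chartTangent Φ φ) (Φ (cos φ, sin φ)) := by
  constructor
  · rw [chartTangent, AffineSubspace.direction_mk']
    exact finrank_span_singleton (chart_linear_ne_zero Φ (direction_ne_zero φ))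
  · ext x
    simp only [Set.mem_inter_iff, SetLike.mem_coe, Set.mem_singleton_iff, mem_chartTangent]
    constructor
    · rintro ⟨⟨r, rfl⟩, h⟩
      rw [hΦ, tangentPoint_sq] at h
      have : r = 0 := by nlinarith
      simp [tangentPoint, this]
    · rintro rfl
      exact ⟨⟨0, by simp [tangentPoint]⟩, (hΦ _).2 (by simp)⟩

/-- In the chart, a line that meets the unit circle once is perpendicular to the radius there. -/
theorem IsTangentAt.exists_angle {Φ : (ℝ × ℝ) ≃ᵃ[ℝ] Plane} {E : Set Plane}
    (hΦ : IsUnitChart Φ E) {L : AffineSubspace ℝ Plane} {y : Plane} (h : IsTangentAt E L y) :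
    ∃ φ, y = Φ (cos φ, sin φ) ∧ L = chartTangent Φ φ := by
  obtain ⟨hf, hL⟩ := h
  have hy : y ∈ (L : Set Plane) ∩ E := by rw [hL]; rfl
  obtain ⟨⟨z1, z2⟩, hz⟩ := Φ.surjective y
  obtain ⟨φ, rfl, rfl⟩ := _root_.exists_angle ((hΦ (z1, z2)).1 (hz ▸ hy.2))
  refine ⟨φ, hz.symm, ?_⟩
  obtain ⟨⟨v, hvL⟩, hv0, hv⟩ := finrank_eq_one_iff'.1 hf
  obtain ⟨⟨w1, w2⟩, hw⟩ := Φ.linear.surjective v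
  have hv0' : v ≠ 0 := fun h => hv0 (Subtype.ext h)
  have hdir : L.direction = Submodule.span ℝ {v} := by
    apply le_antisymm
    · intro x hx
      obtain ⟨c, hc⟩ := hv ⟨x, hx⟩
      exact Submodule.mem_span_singleton.2 ⟨c, congrArg Subtype.val hc⟩
    · rw [Submodule.span_singleton_le_iff_mem]; exact hvL
  have hL' : L = AffineSubspace.mk' y (Submodule.span ℝ {v}) := by
    rw [← hdir, AffineSubspace.mk'_eq hy.1]
  have hcs := sin_sq_add_cos_sq φ
  have hw0 : w1 ^ 2 + w2 ^ 2 ≠ 0 := by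
    intro h0
    apply hv0'
    have e1 : w1 = 0 := by nlinarith [sq_nonneg w1, sq_nonneg w2]
    have e2 : w2 = 0 := by nlinarith [sq_nonneg w1, sq_nonneg w2]
    rw [← hw, e1, e2]
    exact map_zero _
  have hperp : cos φ * w1 + sin φ * w2 = 0 := by
    by_contra hne
    -- The parameter of the second intersection with the circle, if the line is not perpendicular to
    -- the radius.
    set r := -2 * (cos φ * w1 + sin φ * w2) / (w1 ^ 2 + w2 ^ 2) with hr
    have hmem : y + r • v ∈ (L : Set Plane) ∩ E := by
      constructor
      · rw [hL']; exact mem_mk'_span.2 ⟨r, rfl⟩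
      · rw [← hz, ← hw, ← chart_add_smul, hΦ]
        simp only [Prod.smul_mk, Prod.mk_add_mk, smul_eq_mul]
        have : r * (w1 ^ 2 + w2 ^ 2) = -2 * (cos φ * w1 + sin φ * w2) := by
          rw [hr]; field_simp
        linear_combination hcs + r * this
    rw [hL, Set.mem_singleton_iff, add_eq_left, smul_eq_zero] at hmem
    rcases hmem with h | h
    · rw [hr, div_eq_zero_iff] at h
      rcases h with h | h
      · exact hne (by linarith)
      · exact hw0 h
    · exact hv0' h
  set k := cos φ * w2 - sin φ * w1 with hk
  have hwk : ((w1, w2) : ℝ × ℝ) = k • (-sin φ, cos φ) := by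
    ext
    · simp only [Prod.smul_mk, smul_eq_mul, hk]; linear_combination (-w1) * hcs + cos φ * hperp
    · simp only [Prod.smul_mk, smul_eq_mul, hk]; linear_combination (-w2) * hcs + sin φ * hperp
  have hk0 : k ≠ 0 := by
    rintro h0
    rw [h0, zero_smul] at hwk
    exact hv0' (by rw [← hw, hwk]; exact map_zero _)
  rw [hL', chartTangent, ← hw, hwk, map_smul, hz,
    Submodule.span_singleton_smul_eq (IsUnit.mk0 k hk0)]

theorem IsTangent.exists_angle {Φ : (ℝ × ℝ) ≃ᵃ[ℝ] Plane} {E : Set Plane}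
    (hΦ : IsUnitChart Φ E) {L : AffineSubspace ℝ Plane} (h : IsTangent E L) :
    ∃ φ, L = chartTangent Φ φ :=
  let ⟨_, hy⟩ := h
  let ⟨φ, _, hφ⟩ := hy.exists_angle hΦ
  ⟨φ, hφ⟩

/-- Tangency to the ellipse of the line through `Φ z` with direction `Φ.linear w`. -/
theorem isTangent_iff {Φ : (ℝ × ℝ) ≃ᵃ[ℝ] Plane} {E : Set Plane} (hΦ : IsUnitChart Φ E)
    (z : ℝ × ℝ) {w : ℝ × ℝ} (hw : w ≠ 0) :
    IsTangent E (AffineSubspace.mk' (Φ z) (Submodule.span ℝ {Φ.linear w})) ↔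
      w.1 ^ 2 + w.2 ^ 2 = (z.1 * w.2 - z.2 * w.1) ^ 2 := by
  constructor
  · intro h
    obtain ⟨φ, hφ⟩ := h.exists_angle hΦ
    have h1 : Φ z ∈ chartTangent Φ φ := by rw [← hφ]; exact AffineSubspace.self_mem_mk' _ _
    obtain ⟨r, hr⟩ := mem_chartTangent.1 h1
    have hd := congrArg AffineSubspace.direction hφ
    rw [chartTangent, AffineSubspace.direction_mk', AffineSubspace.direction_mk'] at hd
    have h2 : Φ.linear w ∈ Submodule.span ℝ {Φ.linear (-sin φ, cos φ)} := by
      rw [← hd]; exact Submodule.mem_span_singleton_self _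
    obtain ⟨k, hk⟩ := Submodule.mem_span_singleton.1 h2
    rw [← map_smul] at hk
    have hk' := Φ.linear.injective hk
    rw [Φ.injective hr, ← hk']
    simp only [tangentPoint, Prod.smul_mk, smul_eq_mul]
    have hcs := sin_sq_add_cos_sq φ
    linear_combination (-k ^ 2 * (sin φ ^ 2 + cos φ ^ 2)) * hcs
  · intro h
    obtain ⟨z1, z2⟩ := z
    obtain ⟨w1, w2⟩ := w
    simp only at h
    have hw0 : 0 < w1 ^ 2 + w2 ^ 2 := by
      rcases eq_or_ne w1 0 with rfl | h1
      · have : w2 ≠ 0 := by rintro rfl; exact hw rfl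
        positivity
      · positivity
    -- The foot of the perpendicular from the centre; the hypothesis puts it on the unit circle, and
    -- it is the point of contact.
    set r := -(z1 * w1 + z2 * w2) / (w1 ^ 2 + w2 ^ 2) with hr
    have hrw : r * (w1 ^ 2 + w2 ^ 2) = -(z1 * w1 + z2 * w2) := by rw [hr]; field_simp
    have hu : (z1 + r * w1) ^ 2 + (z2 + r * w2) ^ 2 = 1 := by
      apply mul_left_cancel₀ hw0.ne'
      linear_combination (r * (w1 ^ 2 + w2 ^ 2) + (z1 * w1 + z2 * w2)) * hrw - h
    obtain ⟨φ, h1, h2⟩ := _root_.exists_angle hu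
    have hperp : cos φ * w1 + sin φ * w2 = 0 := by
      rw [← h1, ← h2]; linear_combination hrw
    have hcs := sin_sq_add_cos_sq φ
    set k := cos φ * w2 - sin φ * w1 with hk
    have hwk : ((w1, w2) : ℝ × ℝ) = k • (-sin φ, cos φ) := by
      ext
      · simp only [Prod.smul_mk, smul_eq_mul, hk]; linear_combination (-w1) * hcs + cos φ * hperp
      · simp only [Prod.smul_mk, smul_eq_mul, hk]; linear_combination (-w2) * hcs + sin φ * hperp
    have hk0 : k ≠ 0 := by
      rintro h0
      rw [h0, zero_smul] at hwk
      exact hw hwk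
    have hline : AffineSubspace.mk' (Φ (z1, z2)) (Submodule.span ℝ {Φ.linear (w1, w2)}) =
        chartTangent Φ φ := by
      have hmem : Φ (cos φ, sin φ) ∈
          AffineSubspace.mk' (Φ (z1, z2)) (Submodule.span ℝ {Φ.linear (w1, w2)}) := by
        refine mem_mk'_span.2 ⟨r, ?_⟩
        rw [← chart_add_smul, ← h1, ← h2]
        simp
      rw [← AffineSubspace.mk'_eq hmem, AffineSubspace.direction_mk', chartTangent, hwk, map_smul,
        Submodule.span_singleton_smul_eq (IsUnit.mk0 k hk0)]
    rw [hline]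
    exact ⟨_, isTangentAt_chartTangent hΦ φ⟩

/-! ### An ellipse in the chart of another one -/

/-- The equation of the unit circle pulled back by an affine map. -/
def pullbackConic (A : (ℝ × ℝ) ≃ᵃ[ℝ] (ℝ × ℝ)) : Conic where
  a := (A.linear (1, 0)).1 ^ 2 + (A.linear (1, 0)).2 ^ 2
  b := (A.linear (1, 0)).1 * (A.linear (0, 1)).1 + (A.linear (1, 0)).2 * (A.linear (0, 1)).2
  c := (A.linear (0, 1)).1 ^ 2 + (A.linear (0, 1)).2 ^ 2
  d := (A 0).1 * (A.linear (1, 0)).1 + (A 0).2 * (A.linear (1, 0)).2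
  e := (A 0).1 * (A.linear (0, 1)).1 + (A 0).2 * (A.linear (0, 1)).2
  f := (A 0).1 ^ 2 + (A 0).2 ^ 2 - 1

theorem linear_prod (A : (ℝ × ℝ) ≃ₗ[ℝ] (ℝ × ℝ)) (x y : ℝ) :
    A (x, y) = x • A (1, 0) + y • A (0, 1) := by
  rw [← map_smul, ← map_smul, ← map_add]; simp

theorem eval_pullbackConic (A : (ℝ × ℝ) ≃ᵃ[ℝ] (ℝ × ℝ)) (z : ℝ × ℝ) :
    (pullbackConic A).eval z.1 z.2 = (A z).1 ^ 2 + (A z).2 ^ 2 - 1 := by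
  have h : A z = z.1 • A.linear (1, 0) + z.2 • A.linear (0, 1) + A 0 := by
    rw [← linear_prod]
    have := A.map_vadd 0 z
    simpa using this
  rw [h]
  simp only [pullbackConic, Conic.eval, Prod.fst_add, Prod.snd_add, Prod.smul_fst, Prod.smul_snd,
    smul_eq_mul]
  ring

/-- The quadratic coefficient is the squared length of the image of a nonzero tangent direction. -/
theorem surrounds_pullbackConic (A : (ℝ × ℝ) ≃ᵃ[ℝ] (ℝ × ℝ))
    (h : ∀ φ, (A (cos φ, sin φ)).1 ^ 2 + (A (cos φ, sin φ)).2 ^ 2 < 1) :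
    (pullbackConic A).Surrounds where
  const_neg φ := by
    rw [Conic.constCoeff, eval_pullbackConic A (cos φ, sin φ)]
    linarith [h φ]
  quad_pos φ := by
    have h1 : (pullbackConic A).quadCoeff φ =
        (A.linear (-sin φ, cos φ)).1 ^ 2 + (A.linear (-sin φ, cos φ)).2 ^ 2 := by
      rw [linear_prod]
      simp only [pullbackConic, Conic.quadCoeff, Prod.fst_add, Prod.snd_add, Prod.smul_fst,
        Prod.smul_snd, smul_eq_mul]
      ring
    rw [h1]
    have h2 : A.linear (-sin φ, cos φ) ≠ 0 := by simpa using direction_ne_zero φ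
    by_contra hle
    apply h2
    ext
    · simp only [Prod.fst_zero]; nlinarith [sq_nonneg (A.linear (-sin φ, cos φ)).1,
        sq_nonneg (A.linear (-sin φ, cos φ)).2]
    · simp only [Prod.snd_zero]; nlinarith [sq_nonneg (A.linear (-sin φ, cos φ)).1,
        sq_nonneg (A.linear (-sin φ, cos φ)).2]

theorem IsPonceletLine.exists_isCircumscribed {Φ : (ℝ × ℝ) ≃ᵃ[ℝ] Plane} {E C : Set Plane}
    (hΦ : IsUnitChart Φ C) {q : Conic} (hq : ∀ z : ℝ × ℝ, Φ z ∈ E ↔ q.eval z.1 z.2 = 0)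
    {x : ℕ → Plane} (hx : IsPonceletLine E C x) :
    ∃ φ a b, IsCircumscribed q (fun i => Φ.symm (x i)) φ a b := by
  obtain ⟨hE, hne, ht, hturn⟩ := hx
  choose φ hφ using fun i => (ht i).exists_angle hΦ
  have h1 : ∀ i, ∃ r, x i = Φ (tangentPoint (φ i) r) := fun i => by
    rw [← mem_chartTangent, ← hφ]; exact AffineSubspace.self_mem_mk' _ _
  have h2 : ∀ i, ∃ r, x (i + 1) = Φ (tangentPoint (φ i) r) := fun i => by
    rw [← mem_chartTangent, ← hφ, mem_mk'_span]; exact ⟨1, by simp⟩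
  choose a ha using h1
  choose b hb using h2
  refine ⟨φ, a, b, fun i => ?_, fun i => ?_, fun i => ?_, fun i => ?_, fun i => ?_⟩
  · rw [← hq]; simpa using hE i
  · rw [ha i, Φ.symm_apply_apply]
  · rw [hb i, Φ.symm_apply_apply]
  · simpa using hne i
  · simpa using hturn i

/-- Poncelet's porism for two ellipses given by charts. -/
theorem poncelet_of_chart {Φ Ψ : (ℝ × ℝ) ≃ᵃ[ℝ] Plane} {E C : Set Plane} (hΦ : IsUnitChart Φ C)
    (hΨ : IsUnitChart Ψ E) (hin : ∀ z : ℝ × ℝ, z.1 ^ 2 + z.2 ^ 2 = 1 →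
      (Ψ.symm (Φ z)).1 ^ 2 + (Ψ.symm (Φ z)).2 ^ 2 < 1) {n : ℕ} {x y : ℕ → Plane}
    (hx : IsPonceletLine E C x) (hn : x n = x 0) (hy : IsPonceletLine E C y) :
    Function.Periodic y n := by
  have hs := surrounds_pullbackConic (Φ.trans Ψ.symm) fun φ => hin (cos φ, sin φ) (by simp)
  have hq : ∀ z : ℝ × ℝ, Φ z ∈ E ↔ (pullbackConic (Φ.trans Ψ.symm)).eval z.1 z.2 = 0 := fun z => by
    rw [eval_pullbackConic, sub_eq_zero, AffineEquiv.trans_apply, ← hΨ, Ψ.apply_symm_apply]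
  obtain ⟨φ, a, b, H⟩ := hx.exists_isCircumscribed hΦ hq
  obtain ⟨φ', a', b', H'⟩ := hy.exists_isCircumscribed hΦ hq
  have := H'.periodic hs (H.exists_iterate_sameAngle hs (congrArg Φ.symm hn))
  exact fun i => Φ.symm.injective (this i)

/-! ### Ellipses with given foci -/

/-- The orthonormal coordinates obtained by rotating the standard ones by `ω`. -/
def rotLin (ω : ℝ) : (ℝ × ℝ) ≃ₗ[ℝ] Plane where
  toFun z := !₂[z.1 * cos ω - z.2 * sin ω, z.1 * sin ω + z.2 * cos ω]
  invFun p := (p 0 * cos ω + p 1 * sin ω, p 1 * cos ω - p 0 * sin ω)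
  map_add' z w := by ext i; fin_cases i <;> simp <;> ring
  map_smul' r z := by ext i; fin_cases i <;> simp <;> ring
  left_inv z := by
    have := sin_sq_add_cos_sq ω
    ext
    · simp; linear_combination z.1 * this
    · simp; linear_combination z.2 * this
  right_inv p := by
    have := sin_sq_add_cos_sq ω
    ext i
    fin_cases i
    · simp; linear_combination p 0 * this
    · simp; linear_combination p 1 * this

theorem inner_rotLin (ω : ℝ) (z w : ℝ × ℝ) :
    inner ℝ (rotLin ω z) (rotLin ω w) = z.1 * w.1 + z.2 * w.2 := by
  have := sin_sq_add_cos_sq ω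
  simp [rotLin, PiLp.inner_apply, Fin.sum_univ_two]
  linear_combination (z.1 * w.1 + z.2 * w.2) * this

theorem norm_rotLin_sq (ω : ℝ) (z : ℝ × ℝ) : ‖rotLin ω z‖ ^ 2 = z.1 ^ 2 + z.2 ^ 2 := by
  rw [← real_inner_self_eq_norm_sq, inner_rotLin]; ring

/-- Scaling of the coordinates by nonzero factors. -/
def scaleLin {a b : ℝ} (ha : a ≠ 0) (hb : b ≠ 0) : (ℝ × ℝ) ≃ₗ[ℝ] (ℝ × ℝ) :=
  (LinearEquiv.smulOfNeZero ℝ ℝ a ha).prodCongr (LinearEquiv.smulOfNeZero ℝ ℝ b hb)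

/-- The chart with centre `C`, axes rotated by `ω`, and semi-axes `a`, `b`. -/
def frame (C : Plane) (ω : ℝ) {a b : ℝ} (ha : a ≠ 0) (hb : b ≠ 0) : (ℝ × ℝ) ≃ᵃ[ℝ] Plane :=
  ((scaleLin ha hb).trans (rotLin ω)).toAffineEquiv.trans (AffineEquiv.vaddConst ℝ C)

theorem frame_apply (C : Plane) (ω : ℝ) {a b : ℝ} (ha : a ≠ 0) (hb : b ≠ 0) (z : ℝ × ℝ) :
    frame C ω ha hb z = rotLin ω (a * z.1, b * z.2) + C := rfl

theorem frame_linear (C : Plane) (ω : ℝ) {a b : ℝ} (ha : a ≠ 0) (hb : b ≠ 0) (z : ℝ × ℝ) :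
    (frame C ω ha hb).linear z = rotLin ω (a * z.1, b * z.2) := rfl

theorem exists_polar (p : Plane) : ∃ r ω, 0 ≤ r ∧ p = rotLin ω (r, 0) := by
  refine ⟨‖(⟨p 0, p 1⟩ : ℂ)‖, Complex.arg ⟨p 0, p 1⟩, norm_nonneg _, ?_⟩
  ext i
  fin_cases i
  · simp [rotLin, Complex.norm_mul_cos_arg]
  · simp [rotLin, Complex.norm_mul_sin_arg]

/-- Orthonormal coordinates centred at the midpoint of the foci, with the foci on the first axis at
distance `c` from the centre. -/
structure FocalFrame (F₁ F₂ C : Plane) (ω c : ℝ) : Prop where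
  nonneg : 0 ≤ c
  left : F₁ = rotLin ω (-c, 0) + C
  right : F₂ = rotLin ω (c, 0) + C

/-- Coincident foci give `c = 0`, so circles need no separate treatment. -/
theorem exists_focalFrame (F₁ F₂ : Plane) : ∃ C ω c, FocalFrame F₁ F₂ C ω c := by
  obtain ⟨r, ω, hr, h⟩ := exists_polar ((2 : ℝ)⁻¹ • (F₂ - F₁))
  refine ⟨(2 : ℝ)⁻¹ • (F₂ + F₁), ω, r, hr, ?_, ?_⟩
  · have : ((-r, 0) : ℝ × ℝ) = -(r, 0) := by simp
    rw [this, map_neg, ← h]; module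
  · rw [← h]; module

theorem dist_rotLin_add (ω : ℝ) (z w : ℝ × ℝ) (C : Plane) :
    dist (rotLin ω z + C) (rotLin ω w + C) = √((z.1 - w.1) ^ 2 + (z.2 - w.2) ^ 2) := by
  rw [dist_eq_norm, add_sub_add_right_eq_sub, ← map_sub, ← Real.sqrt_sq (norm_nonneg _),
    norm_rotLin_sq]
  rfl

theorem FocalFrame.dist_eq {F₁ F₂ C : Plane} {ω c : ℝ} (h : FocalFrame F₁ F₂ C ω c) :
    dist F₁ F₂ = 2 * c := by
  rw [h.left, h.right, dist_rotLin_add]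
  simp only [sub_self]
  rw [show (-c - c) ^ 2 + 0 ^ 2 = (2 * c) ^ 2 by ring, Real.sqrt_sq (by linarith [h.nonneg])]

/-- The equation of an ellipse, from the sum of the distances to the foci. -/
theorem focal_sum_identity {d₁ d₂ c a b x y : ℝ} (h₁ : d₁ ^ 2 = (a * x + c) ^ 2 + (b * y) ^ 2)
    (h₂ : d₂ ^ 2 = (a * x - c) ^ 2 + (b * y) ^ 2) (hb : b ^ 2 = a ^ 2 - c ^ 2) :
    ((d₁ + d₂) ^ 2 - (2 * a) ^ 2) * ((2 * a) ^ 2 - (d₁ - d₂) ^ 2) =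
      16 * (a ^ 2 * b ^ 2) * (x ^ 2 + y ^ 2 - 1) := by
  have h3 : d₁ ^ 2 - d₂ ^ 2 = 4 * a * c * x := by rw [h₁, h₂]; ring
  have h4 : d₁ ^ 2 + d₂ ^ 2 = 2 * (a ^ 2 * x ^ 2 + c ^ 2 + b ^ 2 * y ^ 2) := by
    rw [h₁, h₂]; ring
  have hc : c ^ 2 = a ^ 2 - b ^ 2 := by linarith
  have : ((d₁ + d₂) ^ 2 - (2 * a) ^ 2) * ((2 * a) ^ 2 - (d₁ - d₂) ^ 2) =
      -(d₁ ^ 2 - d₂ ^ 2) ^ 2 + 8 * a ^ 2 * (d₁ ^ 2 + d₂ ^ 2) - 16 * a ^ 4 := by ring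
  rw [this, h3, h4]
  linear_combination (16 * a ^ 2 - 16 * a ^ 2 * x ^ 2) * hc

/-- By `focal_sum_identity` the two quantities differ by a factor, positive because the triangle
inequality bounds the difference of the focal distances by `2 * c < 2 * a`. One statement thus
yields the curve and its interior. The sign of `b` is left free so that mirrored charts are covered.
-/
theorem FocalFrame.sum_sign {F₁ F₂ C : Plane} {ω c : ℝ} (h : FocalFrame F₁ F₂ C ω c) {a b : ℝ}
    (ha : a ≠ 0) (hb : b ≠ 0) (hca : c < a) (hab : b ^ 2 = a ^ 2 - c ^ 2) (z : ℝ × ℝ) :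
    ∃ k, 0 < k ∧ (dist (frame C ω ha hb z) F₁ + dist (frame C ω ha hb z) F₂ - 2 * a) * k =
      z.1 ^ 2 + z.2 ^ 2 - 1 := by
  have hc := h.nonneg
  set p := frame C ω ha hb z with hp
  have h₁ : dist p F₁ ^ 2 = (a * z.1 + c) ^ 2 + (b * z.2) ^ 2 := by
    rw [hp, h.left, frame_apply, dist_rotLin_add, Real.sq_sqrt (by positivity)]; simp
  have h₂ : dist p F₂ ^ 2 = (a * z.1 - c) ^ 2 + (b * z.2) ^ 2 := by
    rw [hp, h.right, frame_apply, dist_rotLin_add, Real.sq_sqrt (by positivity)]; simp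
  have hdiff : (dist p F₁ - dist p F₂) ^ 2 ≤ (2 * c) ^ 2 := by
    apply sq_le_sq'
    · have := dist_triangle p F₁ F₂
      rw [h.dist_eq] at this; linarith
    · have := dist_triangle p F₂ F₁
      rw [dist_comm F₂, h.dist_eq] at this; linarith
  have hpos : 0 < (2 * a) ^ 2 - (dist p F₁ - dist p F₂) ^ 2 := by nlinarith
  have hsum : 0 < dist p F₁ + dist p F₂ + 2 * a := by
    have := dist_nonneg (x := p) (y := F₁)
    have := dist_nonneg (x := p) (y := F₂)
    linarith
  have hid := focal_sum_identity h₁ h₂ hab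
  have hq : 0 < 16 * (a ^ 2 * b ^ 2) := by positivity
  refine ⟨(dist p F₁ + dist p F₂ + 2 * a) * ((2 * a) ^ 2 - (dist p F₁ - dist p F₂) ^ 2) /
    (16 * (a ^ 2 * b ^ 2)), by positivity, ?_⟩
  rw [mul_div_assoc', div_eq_iff hq.ne']
  linear_combination hid

theorem FocalFrame.isUnitChart {F₁ F₂ C : Plane} {ω c : ℝ} (h : FocalFrame F₁ F₂ C ω c) {s a b : ℝ}
    (ha : a ≠ 0) (hb : b ≠ 0) (hca : c < a) (hab : b ^ 2 = a ^ 2 - c ^ 2) (hs : s = 2 * a) :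
    IsUnitChart (frame C ω ha hb) (ellipse F₁ F₂ s) := fun z => by
  obtain ⟨k, hk, he⟩ := h.sum_sign ha hb hca hab z
  rw [ellipse, Set.mem_ofPred_eq, hs, ← sub_eq_zero, ← sub_eq_zero (b := (1 : ℝ)), ← he]
  simp [hk.ne']

theorem FocalFrame.mem_interior {F₁ F₂ C : Plane} {ω c : ℝ} (h : FocalFrame F₁ F₂ C ω c)
    {s a b : ℝ} (ha : a ≠ 0) (hb : b ≠ 0) (hca : c < a) (hab : b ^ 2 = a ^ 2 - c ^ 2)
    (hs : s = 2 * a) (z : ℝ × ℝ) :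
    frame C ω ha hb z ∈ ellipseInterior F₁ F₂ s ↔ z.1 ^ 2 + z.2 ^ 2 < 1 := by
  obtain ⟨k, hk, he⟩ := h.sum_sign ha hb hca hab z
  rw [ellipseInterior, Set.mem_ofPred_eq, hs, ← sub_neg, ← sub_neg (b := (1 : ℝ)), ← he]
  exact ⟨fun h' => mul_neg_of_neg_of_pos h' hk,
    fun h' => lt_of_not_ge fun h'' => absurd (mul_nonneg h'' hk.le) (not_le.2 h')⟩

/-- The minor semi-axis. -/
theorem exists_minor {c a : ℝ} (hc : 0 ≤ c) (hca : c < a) :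
    ∃ b, 0 < b ∧ b ^ 2 = a ^ 2 - c ^ 2 := by
  have : 0 < a ^ 2 - c ^ 2 := by nlinarith
  exact ⟨√(a ^ 2 - c ^ 2), Real.sqrt_pos.2 this, Real.sq_sqrt this.le⟩

theorem poncelet_porism {F₁ F₂ G₁ G₂ : Plane} {s t : ℝ} (hs : dist F₁ F₂ < s)
    (ht : dist G₁ G₂ < t) (hin : ellipse G₁ G₂ t ⊆ ellipseInterior F₁ F₂ s) {n : ℕ}
    {x y : ℕ → Plane} (hx : IsPonceletLine (ellipse F₁ F₂ s) (ellipse G₁ G₂ t) x)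
    (hn : x n = x 0) (hy : IsPonceletLine (ellipse F₁ F₂ s) (ellipse G₁ G₂ t) y) :
    Function.Periodic y n := by
  obtain ⟨C, ω, c, hF⟩ := exists_focalFrame F₁ F₂
  obtain ⟨C', ω', c', hG⟩ := exists_focalFrame G₁ G₂
  rw [hF.dist_eq] at hs
  rw [hG.dist_eq] at ht
  have hcs : c < s / 2 := by linarith
  have hct : c' < t / 2 := by linarith
  obtain ⟨b, hb, hb'⟩ := exists_minor hF.nonneg hcs
  obtain ⟨d, hd, hd'⟩ := exists_minor hG.nonneg hct
  have hs0 : s / 2 ≠ 0 := by have := hF.nonneg; linarith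
  have ht0 : t / 2 ≠ 0 := by have := hG.nonneg; linarith
  have hΦ := hG.isUnitChart ht0 hd.ne' hct hd' (s := t) (by ring)
  have hΨ := hF.isUnitChart hs0 hb.ne' hcs hb' (s := s) (by ring)
  refine poncelet_of_chart hΦ hΨ (fun z hz => ?_) hx hn hy
  rw [← hF.mem_interior hs0 hb.ne' hcs hb' (s := s) (by ring), AffineEquiv.apply_symm_apply]
  exact hin ((hΦ z).2 hz)

/-! ### The optical property of confocal ellipses -/

/-- The mirror image of `v` in the line spanned by `θ`. -/
def mirror (θ v : ℝ × ℝ) : ℝ × ℝ :=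
  (2 * (θ.1 * v.1 + θ.2 * v.2) / (θ.1 ^ 2 + θ.2 ^ 2)) • θ - v

theorem reflection_rotLin (ω : ℝ) (θ v : ℝ × ℝ) {K : Submodule ℝ Plane}
    [K.HasOrthogonalProjection] (hK : K = Submodule.span ℝ {rotLin ω θ}) :
    K.reflection (rotLin ω v) = rotLin ω (mirror θ v) := by
  subst hK
  rw [Submodule.reflection_singleton_apply, inner_rotLin, mirror, map_sub, map_smul]
  simp only [RCLike.ofReal_real_eq_id, id_eq, norm_rotLin_sq]
  rw [← Nat.cast_smul_eq_nsmul ℝ, smul_smul, mul_div_assoc]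
  norm_num

/-- The quadratic form in the direction `v` that vanishes when the line through `p` with direction
`v` is tangent to the ellipse with semi-axes `a` and `b`. -/
def causticForm (a b : ℝ) (p v : ℝ × ℝ) : ℝ :=
  a ^ 2 * v.2 ^ 2 + b ^ 2 * v.1 ^ 2 - (p.1 * v.2 - p.2 * v.1) ^ 2

theorem isTangent_frame_iff {C : Plane} {ω a b : ℝ} {ha : a ≠ 0} {hb : b ≠ 0} {E : Set Plane}
    (hE : IsUnitChart (frame C ω ha hb) E) (p : ℝ × ℝ) {v : ℝ × ℝ} (hv : v ≠ 0) :
    IsTangent E (AffineSubspace.mk' (rotLin ω p + C) (Submodule.span ℝ {rotLin ω v})) ↔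
      causticForm a b p v = 0 := by
  have h1 : rotLin ω p + C = frame C ω ha hb (p.1 / a, p.2 / b) := by
    rw [frame_apply]; congr 2; ext <;> simp <;> field_simp
  have h2 : rotLin ω v = (frame C ω ha hb).linear (v.1 / a, v.2 / b) := by
    rw [frame_linear]; congr 1; ext <;> simp <;> field_simp
  have h3 : ((v.1 / a, v.2 / b) : ℝ × ℝ) ≠ 0 := by
    contrapose! hv
    simp only [Prod.mk_eq_zero, div_eq_zero_iff, ha, hb, or_false] at hv
    exact Prod.ext hv.1 hv.2
  rw [h1, h2, isTangent_iff hE _ h3, causticForm]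
  simp only
  constructor
  · intro h
    field_simp at h
    linear_combination h
  · intro h
    field_simp
    linear_combination h

theorem causticForm_smul (a b r : ℝ) (p v : ℝ × ℝ) :
    causticForm a b p (r • v) = r ^ 2 * causticForm a b p v := by
  simp only [causticForm, Prod.smul_fst, Prod.smul_snd, smul_eq_mul]; ring

/-- Confocal ellipses with semi-axes `a`, `b` and `A`, `B`, the first inside the second. -/
structure IsNested (a b A B : ℝ) : Prop where
  a_pos : 0 < a
  b_ne : b ≠ 0
  A_pos : 0 < A
  B_pos : 0 < B
  lt : a < A
  confocal : A ^ 2 - a ^ 2 = B ^ 2 - b ^ 2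

namespace IsNested

variable {a b A B : ℝ}

theorem diff_pos (h : IsNested a b A B) : 0 < A ^ 2 - a ^ 2 := by
  have := h.a_pos; have := h.lt; nlinarith

theorem tangent_sq_pos (h : IsNested a b A B) (ψ : ℝ) :
    0 < (-(A * sin ψ)) ^ 2 + (B * cos ψ) ^ 2 := by
  rw [neg_sq]
  have h1 := h.A_pos
  have h2 := h.B_pos
  have := sin_sq_add_cos_sq ψ
  rcases eq_or_ne (sin ψ) 0 with h0 | h0
  · have : cos ψ ≠ 0 := by rintro h3; rw [h0, h3] at this; norm_num at this
    positivity
  · positivity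

/-- Put `l = A² - a² = B² - b²`. At the point `(A cos ψ, B sin ψ)` the form equals `⟨N, v⟩² - l
|v|²` with the normal `N = (B cos ψ, A sin ψ)`. Reflection in the tangent keeps `|v|` and changes
the sign of `⟨N, v⟩`. -/
theorem causticForm_mirror (h : IsNested a b A B) (ψ : ℝ) (v : ℝ × ℝ) :
    causticForm a b (A * cos ψ, B * sin ψ) (mirror (-(A * sin ψ), B * cos ψ) v) =
      causticForm a b (A * cos ψ, B * sin ψ) v := by
  have hM := (h.tangent_sq_pos ψ).ne'
  have hcs := sin_sq_add_cos_sq ψ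
  have ha : a ^ 2 = A ^ 2 - (B ^ 2 - b ^ 2) := by linarith [h.confocal]
  obtain ⟨v1, v2⟩ := v
  simp only [mirror, causticForm, Prod.smul_mk, smul_eq_mul, Prod.fst_sub, Prod.snd_sub]
  set k := 2 * (-(A * sin ψ) * v1 + B * cos ψ * v2) / ((-(A * sin ψ)) ^ 2 + (B * cos ψ) ^ 2) with hk
  have hk' : k * ((-(A * sin ψ)) ^ 2 + (B * cos ψ) ^ 2) =
      2 * (-(A * sin ψ) * v1 + B * cos ψ * v2) := by rw [hk, div_mul_cancel₀ _ hM]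
  -- The determinant of the position vector and the tangent vector is `A * B`.
  have hy : A * cos ψ * (k * (B * cos ψ) - v2) - B * sin ψ * (k * (-(A * sin ψ)) - v1) =
      k * (A * B) - (A * cos ψ * v2 - B * sin ψ * v1) := by
    linear_combination (k * A * B) * hcs
  rw [hy, ha]
  linear_combination (-(B ^ 2 - b ^ 2) * k) * hk' + k ^ 2 * A ^ 2 * B ^ 2 * hcs

/-- Only tangent and normal directions are reflected into multiples of themselves. The form is
negative on the former and positive on the latter, so it vanishes on neither. -/
theorem mirror_ne_smul (h : IsNested a b A B) (ψ : ℝ) {v : ℝ × ℝ} (hv : v ≠ 0)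
    (hN : causticForm a b (A * cos ψ, B * sin ψ) v = 0) (μ : ℝ) :
    mirror (-(A * sin ψ), B * cos ψ) v ≠ μ • v := by
  intro heq
  have hM := h.tangent_sq_pos ψ
  have hcs := sin_sq_add_cos_sq ψ
  have hd := h.diff_pos
  have ha : a ^ 2 = A ^ 2 - (A ^ 2 - a ^ 2) := by ring
  have hb : b ^ 2 = B ^ 2 - (A ^ 2 - a ^ 2) := by linarith [h.confocal]
  have hA := h.A_pos
  have hB := h.B_pos
  obtain ⟨v1, v2⟩ := v
  have e1 := congrArg Prod.fst heq
  have e2 := congrArg Prod.snd heq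
  simp only [mirror, causticForm, Prod.smul_mk, smul_eq_mul, Prod.fst_sub, Prod.snd_sub]
    at e1 e2 hN
  set k := 2 * (-(A * sin ψ) * v1 + B * cos ψ * v2) / ((-(A * sin ψ)) ^ 2 + (B * cos ψ) ^ 2) with hk
  have hk' : k * ((-(A * sin ψ)) ^ 2 + (B * cos ψ) ^ 2) =
      2 * (-(A * sin ψ) * v1 + B * cos ψ * v2) := by rw [hk, div_mul_cancel₀ _ hM.ne']
  set l := A ^ 2 - a ^ 2 with hl
  rw [ha, hb] at hN
  -- For `k = 0` the vector `v` is normal to the outer ellipse; otherwise it is tangent to it.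
  by_cases hk0 : k = 0
  · have hperp : A * sin ψ * v1 = B * cos ψ * v2 := by
      rw [hk0] at hk'; linarith
    have hpos : 0 < a ^ 2 * sin ψ ^ 2 + b ^ 2 * cos ψ ^ 2 := by
      have h1 := h.a_pos
      have h2 := h.b_ne
      rcases eq_or_ne (sin ψ) 0 with h0 | h0
      · have : cos ψ ≠ 0 := by rintro h3; rw [h0, h3] at hcs; norm_num at hcs
        positivity
      · positivity
    set m := B * cos ψ * v1 + A * sin ψ * v2 with hm
    set M := (-(A * sin ψ)) ^ 2 + (B * cos ψ) ^ 2 with hMdef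
    have hv1 : M * v1 = m * (B * cos ψ) := by
      rw [hMdef, hm]; linear_combination (A * sin ψ) * hperp
    have hv2 : M * v2 = m * (A * sin ψ) := by
      rw [hMdef, hm]; linear_combination (-B * cos ψ) * hperp
    have hmm : m ^ 2 * (M * (a ^ 2 * sin ψ ^ 2 + b ^ 2 * cos ψ ^ 2)) = 0 := by
      have h3 : (A ^ 2 - l) * (M * v2) ^ 2 + (B ^ 2 - l) * (M * v1) ^ 2
          - (A * cos ψ * (M * v2) - B * sin ψ * (M * v1)) ^ 2 = 0 := by
        linear_combination M ^ 2 * hN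
      rw [hv1, hv2] at h3
      rw [ha, hb, hMdef]
      have hc2 : cos ψ ^ 2 = 1 - sin ψ ^ 2 := by linarith
      have h4 : m ^ 2 * ((A ^ 2 - l) * (A * sin ψ) ^ 2 + (B ^ 2 - l) * (B * cos ψ) ^ 2
          - cos ψ ^ 2 * sin ψ ^ 2 * (A ^ 2 - B ^ 2) ^ 2) = 0 := by linear_combination h3
      rw [← h4]
      simp only [neg_sq, mul_pow, hc2]
      ring
    have hm0 : m = 0 := by
      rcases mul_eq_zero.1 hmm with h5 | h5
      · exact pow_eq_zero_iff (two_ne_zero) |>.1 h5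
      · exact absurd h5 (mul_pos hM hpos).ne'
    rw [hm0, zero_mul] at hv1 hv2
    apply hv
    ext
    · exact (mul_eq_zero.1 hv1).resolve_left hM.ne'
    · exact (mul_eq_zero.1 hv2).resolve_left hM.ne'
  · have f1 : k * -(A * sin ψ) = (1 + μ) * v1 := by linarith
    have f2 : k * (B * cos ψ) = (1 + μ) * v2 := by linarith
    have h3 : (A ^ 2 - l) * ((1 + μ) * v2) ^ 2 + (B ^ 2 - l) * ((1 + μ) * v1) ^ 2
        - (A * cos ψ * ((1 + μ) * v2) - B * sin ψ * ((1 + μ) * v1)) ^ 2 = 0 := by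
      linear_combination (1 + μ) ^ 2 * hN
    rw [← f1, ← f2] at h3
    have h4 : k ^ 2 * (l * ((-(A * sin ψ)) ^ 2 + (B * cos ψ) ^ 2)) = 0 := by
      linear_combination -h3 - k ^ 2 * A ^ 2 * B ^ 2 * (sin ψ ^ 2 + cos ψ ^ 2) * hcs
    have : 0 < k ^ 2 * (l * ((-(A * sin ψ)) ^ 2 + (B * cos ψ) ^ 2)) := by positivity
    exact this.ne' h4

end IsNested

theorem Reflects.exists_mirror {C : Plane} {ω A B : ℝ} {hA : A ≠ 0} {hB : B ≠ 0} {E : Set Plane}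
    (hE : IsUnitChart (frame C ω hA hB) E) {y w : Plane} {u : ℝ × ℝ}
    (h : Reflects E y (rotLin ω u) w) :
    ∃ ψ, y = rotLin ω (A * cos ψ, B * sin ψ) + C ∧
      SameRay ℝ (rotLin ω (mirror (-(A * sin ψ), B * cos ψ) u)) w := by
  obtain ⟨L, hL, hr⟩ := h
  obtain ⟨ψ, hy, rfl⟩ := hL.exists_angle hE
  refine ⟨ψ, hy, ?_⟩
  rwa [reflection_rotLin ω (-(A * sin ψ), B * cos ψ)] at hr
  rw [chartTangent, AffineSubspace.direction_mk', frame_linear]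
  simp

/-- A line tangent to an ellipse `D` that is reflected in a confocal ellipse `E` around `D` stays
tangent to `D` and does not come back on itself. -/
theorem IsNested.reflects {C : Plane} {ω a b A B : ℝ} (h : IsNested a b A B) {D E : Set Plane}
    (hD : IsUnitChart (frame C ω h.a_pos.ne' h.b_ne) D)
    (hE : IsUnitChart (frame C ω h.A_pos.ne' h.B_pos.ne') E) {y u w : Plane} (hu : u ≠ 0)
    (hw : w ≠ 0) (hr : Reflects E y u w) :
    (IsTangent D (AffineSubspace.mk' y (Submodule.span ℝ {u})) ↔
      IsTangent D (AffineSubspace.mk' y (Submodule.span ℝ {w}))) ∧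
    (IsTangent D (AffineSubspace.mk' y (Submodule.span ℝ {u})) → ∀ μ : ℝ, w ≠ μ • u) := by
  obtain ⟨u, rfl⟩ := (rotLin ω).surjective u
  have hu' : u ≠ 0 := by simpa using hu
  obtain ⟨ψ, rfl, hs⟩ := hr.exists_mirror hE
  obtain ⟨w, rfl⟩ := (rotLin ω).surjective w
  have hw' : w ≠ 0 := by simpa using hw
  -- A zero mirror image would make the form vanish at `u`, and the image would be the multiple `0 •
  -- u`.
  have hm : mirror (-(A * sin ψ), B * cos ψ) u ≠ 0 := by
    intro h0
    have := h.causticForm_mirror ψ u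
    rw [h0] at this
    exact h.mirror_ne_smul ψ hu' (by rw [← this]; simp [causticForm]) 0 (by rw [h0, zero_smul])
  obtain ⟨r, hr0, hr⟩ := hs.exists_pos_left (by simpa using hm) hw
  rw [← map_smul] at hr
  have hr := (rotLin ω).injective hr
  rw [isTangent_frame_iff hD _ hu', isTangent_frame_iff hD _ hw', ← hr, causticForm_smul,
    h.causticForm_mirror]
  refine ⟨by simp [hr0.ne'], fun hN μ heq => ?_⟩
  rw [← map_smul] at heq
  have heq := (rotLin ω).injective heq
  apply h.mirror_ne_smul ψ hu' hN (r⁻¹ * μ)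
  rw [mul_smul, ← heq, smul_smul, inv_mul_cancel₀ hr0.ne', one_smul]

theorem mk'_add_self (x v : Plane) :
    AffineSubspace.mk' (x + v) (Submodule.span ℝ {v}) =
      AffineSubspace.mk' x (Submodule.span ℝ {v}) := by
  have h : x + v ∈ AffineSubspace.mk' x (Submodule.span ℝ {v}) := mem_mk'_span.2 ⟨1, by simp⟩
  conv_rhs => rw [← AffineSubspace.mk'_eq h, AffineSubspace.direction_mk']

theorem FocalFrame.isNested {F₁ F₂ C : Plane} {ω c : ℝ} (h : FocalFrame F₁ F₂ C ω c)
    {a b A B : ℝ} (hca : c < a) (hb : b ≠ 0) (hab : b ^ 2 = a ^ 2 - c ^ 2) (hB : 0 < B)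
    (hAB : B ^ 2 = A ^ 2 - c ^ 2) (hlt : a < A) : IsNested a b A B := by
  have := h.nonneg
  exact ⟨by linarith, hb, by linarith, hB, hlt, by linarith⟩

/-- Each reflection preserves tangency in both directions, so one tangent segment makes all of them
tangent. -/
theorem IsBilliardTrajectory.isPonceletLine {F₁ F₂ : Plane} {s t : ℝ} (ht : dist F₁ F₂ < t)
    (hts : t < s) {x : ℕ → Plane} (hx : IsBilliardTrajectory (ellipse F₁ F₂ s) x)
    (hxt : IsTangentTrajectory (ellipse F₁ F₂ t) x) :
    IsPonceletLine (ellipse F₁ F₂ s) (ellipse F₁ F₂ t) x := by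
  obtain ⟨C, ω, c, hF⟩ := exists_focalFrame F₁ F₂
  rw [hF.dist_eq] at ht
  have hct : c < t / 2 := by linarith
  have hcs : c < s / 2 := by linarith
  obtain ⟨b, hb, hb'⟩ := exists_minor hF.nonneg hct
  obtain ⟨B, hB, hB'⟩ := exists_minor hF.nonneg hcs
  have hN := hF.isNested hct hb.ne' hb' hB hB' (by linarith)
  have hD := hF.isUnitChart hN.a_pos.ne' hN.b_ne hct hb' (s := t) (by ring)
  have hE := hF.isUnitChart hN.A_pos.ne' hN.B_pos.ne' hcs hB' (s := s) (by ring)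
  obtain ⟨hxE, hne, hr⟩ := hx
  have hkey := fun i =>
    hN.reflects hD hE (sub_ne_zero.2 (hne i)) (sub_ne_zero.2 (hne (i + 1))) (hr i)
  have hline : ∀ i, AffineSubspace.mk' (x (i + 1)) (Submodule.span ℝ {x (i + 1) - x i}) =
      AffineSubspace.mk' (x i) (Submodule.span ℝ {x (i + 1) - x i}) := fun i => by
    have := mk'_add_self (x i) (x (i + 1) - x i)
    rwa [add_sub_cancel] at this
  simp only [hline] at hkey
  have hall : ∀ i j, IsTangent (ellipse F₁ F₂ t)
      (AffineSubspace.mk' (x i) (Submodule.span ℝ {x (i + 1) - x i})) ↔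
      IsTangent (ellipse F₁ F₂ t)
      (AffineSubspace.mk' (x j) (Submodule.span ℝ {x (j + 1) - x j})) := by
    have h0 : ∀ i, IsTangent (ellipse F₁ F₂ t)
        (AffineSubspace.mk' (x 0) (Submodule.span ℝ {x (0 + 1) - x 0})) ↔
        IsTangent (ellipse F₁ F₂ t)
        (AffineSubspace.mk' (x i) (Submodule.span ℝ {x (i + 1) - x i})) := fun i => by
      induction i with
      | zero => rfl
      | succ i ih => exact ih.trans (hkey i).1
    exact fun i j => (h0 i).symm.trans (h0 j)
  obtain ⟨i₀, hi₀⟩ := hxt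
  have htan := fun i => (hall i₀ i).1 hi₀
  -- Returning to `x i` would reverse the direction, which is the excluded factor `-1`.
  refine ⟨hxE, hne, htan, fun i heq => (hkey i).2 (htan i) (-1) ?_⟩
  rw [heq]; simp

/-- A tangent line avoids the interior of its ellipse, which excludes `s < t`; it has only one point
on the ellipse, which excludes `s = t`. -/
theorem IsTangent.lt_of_chord {F₁ F₂ : Plane} {s t : ℝ} (ht : dist F₁ F₂ < t) {x y : Plane}
    (hx : x ∈ ellipse F₁ F₂ s) (hy : y ∈ ellipse F₁ F₂ s) (hxy : y ≠ x)
    (h : IsTangent (ellipse F₁ F₂ t) (AffineSubspace.mk' x (Submodule.span ℝ {y - x}))) :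
    t < s := by
  obtain ⟨C, ω, c, hF⟩ := exists_focalFrame F₁ F₂
  rw [hF.dist_eq] at ht
  have hct : c < t / 2 := by linarith
  have h0 : t / 2 ≠ 0 := by have := hF.nonneg; linarith
  obtain ⟨b, hb, hb'⟩ := exists_minor hF.nonneg hct
  have hD := hF.isUnitChart h0 hb.ne' hct hb' (s := t) (by ring)
  by_contra hle
  obtain ⟨φ, hφ⟩ := h.exists_angle hD
  have hxL : x ∈ AffineSubspace.mk' x (Submodule.span ℝ {y - x}) := AffineSubspace.self_mem_mk' _ _
  have hyL : y ∈ AffineSubspace.mk' x (Submodule.span ℝ {y - x}) :=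
    mem_mk'_span.2 ⟨1, by simp⟩
  have hst : s = t := by
    refine le_antisymm (not_lt.1 hle) (not_lt.1 fun hlt => ?_)
    rw [hφ] at hxL
    obtain ⟨r, hr⟩ := mem_chartTangent.1 hxL
    have : x ∈ ellipseInterior F₁ F₂ t := lt_of_eq_of_lt hx hlt
    rw [hr, hF.mem_interior h0 hb.ne' hct hb' (by ring), tangentPoint_sq] at this
    nlinarith [sq_nonneg r]
  obtain ⟨z, -, hz⟩ := h
  rw [hst] at hx hy
  have h1 : x ∈ ({z} : Set Plane) := hz ▸ ⟨hxL, hx⟩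
  have h2 : y ∈ ({z} : Set Plane) := hz ▸ ⟨hyL, hy⟩
  rw [Set.mem_singleton_iff] at h1 h2
  exact hxy (h2.trans h1.symm)

theorem billiard_porism {F₁ F₂ : Plane} {s t : ℝ} (hs : dist F₁ F₂ < s) (ht : dist F₁ F₂ < t)
    {n : ℕ} {x : ℕ → Plane} (hx : IsBilliardTrajectory (ellipse F₁ F₂ s) x)
    (hxt : IsTangentTrajectory (ellipse F₁ F₂ t) x) (hn : Function.Periodic x n)
    {y : ℕ → Plane} (hy : IsBilliardTrajectory (ellipse F₁ F₂ s) y)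
    (hyt : IsTangentTrajectory (ellipse F₁ F₂ t) y) : Function.Periodic y n := by
  have hts : t < s := by
    obtain ⟨i, hi⟩ := hxt
    exact hi.lt_of_chord ht (hx.1 i) (hx.1 (i + 1)) (hx.2.1 i)
  refine poncelet_porism hs ht (fun p hp => lt_of_eq_of_lt hp hts)
    (hx.isPonceletLine ht hts hxt) ?_ (hy.isPonceletLine ht hts hyt)
  simpa using hn 0

/-! ### The billiard ball map on the tangent lines of a confocal ellipse -/

/-- The ellipse with major semi-axis `A` and half focal distance `c`, in the chart of the confocal
ellipse with major semi-axis `a`. -/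
def confocalConic (c a A : ℝ) : Conic where
  a := a ^ 2 / A ^ 2
  b := 0
  c := (a ^ 2 - c ^ 2) / (A ^ 2 - c ^ 2)
  d := 0
  e := 0
  f := -1

theorem confocal_bounds {c a A : ℝ} (hc : 0 ≤ c) (hca : c < a) (haA : a < A) :
    0 < a ^ 2 - c ^ 2 ∧ a ^ 2 - c ^ 2 < A ^ 2 - c ^ 2 ∧ 0 < a ^ 2 ∧ a ^ 2 < A ^ 2 := by
  refine ⟨?_, ?_, ?_, ?_⟩ <;> nlinarith

theorem combination_pos {x y : ℝ} (hx : 0 < x) (hy : 0 < y) (φ : ℝ) :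
    0 < x * sin φ ^ 2 + y * cos φ ^ 2 := by
  have h := sin_sq_add_cos_sq φ
  rcases eq_or_ne (sin φ) 0 with h0 | h0
  · have : cos φ ≠ 0 := by rintro h3; rw [h0, h3] at h; norm_num at h
    positivity
  · positivity

theorem surrounds_confocalConic {c a A : ℝ} (hc : 0 ≤ c) (hca : c < a) (haA : a < A) :
    (confocalConic c a A).Surrounds := by
  obtain ⟨h1, h2, h3, h4⟩ := confocal_bounds hc hca haA
  have hp := div_pos h3 (h3.trans h4)
  have hq := div_pos h1 (h1.trans h2)
  have hp1 := (div_lt_one (h3.trans h4)).2 h4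
  have hq1 := (div_lt_one (h1.trans h2)).2 h2
  constructor
  · intro φ
    have := combination_pos hp hq φ
    simpa [Conic.quadCoeff, confocalConic] using this
  · intro φ
    have := combination_pos (sub_pos.2 hq1) (sub_pos.2 hp1) φ
    have hcs := sin_sq_add_cos_sq φ
    simp only [Conic.constCoeff, Conic.eval, confocalConic]
    linarith

/-- The density on the inner ellipse that is invariant under the billiards in all confocal
ellipses around it. -/
def confocalDensity (c a φ : ℝ) : ℝ := √(a ^ 2 * sin φ ^ 2 + (a ^ 2 - c ^ 2) * cos φ ^ 2)

/-- The outer ellipse enters only through a constant factor, which cancels in the derivative of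
`next`. All confocal ellipses thus share one invariant density. -/
theorem disc_confocalConic {c a A : ℝ} (hc : 0 ≤ c) (hca : c < a) (haA : a < A) (φ : ℝ) :
    (confocalConic c a A).disc φ = (A ^ 2 - a ^ 2) / (A ^ 2 * (A ^ 2 - c ^ 2)) *
      (a ^ 2 * sin φ ^ 2 + (a ^ 2 - c ^ 2) * cos φ ^ 2) := by
  obtain ⟨h1, h2, h3, h4⟩ := confocal_bounds hc hca haA
  have hA := (h3.trans h4).ne'
  have hB := (h1.trans h2).ne'
  have hc2 : cos φ ^ 2 = 1 - sin φ ^ 2 := by linarith [sin_sq_add_cos_sq φ]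
  have hA' : A ≠ 0 := by rintro rfl; simp at hA
  simp only [Conic.disc, Conic.quadCoeff, Conic.linCoeff, Conic.constCoeff, Conic.eval,
    confocalConic]
  have e : (-(a ^ 2 / A ^ 2) * sin φ * cos φ + 0 * (cos φ ^ 2 - sin φ ^ 2) +
      (a ^ 2 - c ^ 2) / (A ^ 2 - c ^ 2) * sin φ * cos φ - 0 * sin φ + 0 * cos φ) ^ 2 =
      ((a ^ 2 - c ^ 2) / (A ^ 2 - c ^ 2) - a ^ 2 / A ^ 2) ^ 2 * sin φ ^ 2 * cos φ ^ 2 := by ring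
  rw [e, hc2]
  field_simp
  ring

theorem confocalDensity_pos {c a : ℝ} (hc : 0 ≤ c) (hca : c < a) (φ : ℝ) :
    0 < confocalDensity c a φ :=
  Real.sqrt_pos.2 (combination_pos (by nlinarith) (by nlinarith) φ)

theorem continuous_confocalDensity (c a : ℝ) : Continuous (confocalDensity c a) := by
  unfold confocalDensity; fun_prop

theorem isTranslationFor_confocalConic {c a A : ℝ} (hc : 0 ≤ c) (hca : c < a) (haA : a < A) :
    IsTranslationFor (confocalDensity c a) (confocalConic c a A).next := by
  refine isTranslationFor_of_hasDerivAt (continuous_confocalDensity c a)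
    (confocalDensity_pos hc hca) fun φ => ?_
  obtain ⟨h1, h2, h3, h4⟩ := confocal_bounds hc hca haA
  refine ((surrounds_confocalConic hc hca haA).hasDerivAt_next φ).congr_deriv ?_
  have hk : 0 < (A ^ 2 - a ^ 2) / (A ^ 2 * (A ^ 2 - c ^ 2)) :=
    div_pos (by linarith) (mul_pos (by linarith) (by linarith))
  rw [disc_confocalConic hc hca haA, disc_confocalConic hc hca haA, Real.sqrt_mul hk.le,
    Real.sqrt_mul hk.le, mul_div_mul_left _ _ (Real.sqrt_pos.2 hk).ne']
  rfl

/-- The tangent line at angle `φ`, oriented in the direction of increasing angles. -/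
def orientedTangent (Φ : (ℝ × ℝ) ≃ᵃ[ℝ] Plane) (φ : ℝ) : OrientedLine where
  line := chartTangent Φ φ
  dir := ‖Φ.linear (-sin φ, cos φ)‖⁻¹ • Φ.linear (-sin φ, cos φ)
  norm_dir := norm_smul_inv_norm (𝕜 := ℝ) (chart_linear_ne_zero Φ (direction_ne_zero φ))
  line_eq := ⟨Φ (cos φ, sin φ), by
    rw [chartTangent, Submodule.span_singleton_smul_eq (IsUnit.mk0 _ (inv_ne_zero
      (norm_ne_zero_iff.2 (chart_linear_ne_zero Φ (direction_ne_zero φ)))))]⟩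

theorem orientedTangent_congr (Φ : (ℝ × ℝ) ≃ᵃ[ℝ] Plane) {φ ψ : ℝ} (h : SameAngle φ ψ) :
    orientedTangent Φ φ = orientedTangent Φ ψ := by
  simp only [orientedTangent, chartTangent, h.1, h.2]

theorem sameAngle_of_orientedTangent_eq {Φ : (ℝ × ℝ) ≃ᵃ[ℝ] Plane} {E : Set Plane}
    (hΦ : IsUnitChart Φ E) {φ ψ : ℝ} (h : orientedTangent Φ φ = orientedTangent Φ ψ) :
    SameAngle φ ψ := by
  have h1 : chartTangent Φ φ = chartTangent Φ ψ := congrArg OrientedLine.line h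
  have h2 := (isTangentAt_chartTangent hΦ φ).2
  rw [h1, (isTangentAt_chartTangent hΦ ψ).2, Set.singleton_eq_singleton_iff] at h2
  have h3 := Φ.injective h2
  exact ⟨(congrArg Prod.fst h3).symm, (congrArg Prod.snd h3).symm⟩

theorem OrientedLine.line_eq_of_mem (ℓ : OrientedLine) {y : Plane} (hy : y ∈ ℓ.line) :
    ℓ.line = AffineSubspace.mk' y (Submodule.span ℝ {ℓ.dir}) := by
  obtain ⟨p, hp⟩ := ℓ.line_eq
  rw [← AffineSubspace.mk'_eq hy]
  congr 1
  rw [hp, AffineSubspace.direction_mk']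

theorem OrientedLine.eq_orientedTangent {Φ : (ℝ × ℝ) ≃ᵃ[ℝ] Plane} {ℓ : OrientedLine} {y : Plane}
    {φ : ℝ} (hy : y ∈ ℓ.line) (hy' : y ∈ chartTangent Φ φ)
    (h : SameRay ℝ (Φ.linear (-sin φ, cos φ)) ℓ.dir) : ℓ = orientedTangent Φ φ := by
  have h0 := chart_linear_ne_zero Φ (direction_ne_zero φ)
  have hdir : ℓ.dir = (orientedTangent Φ φ).dir := by
    have h1 : SameRay ℝ (orientedTangent Φ φ).dir ℓ.dir :=
      h.pos_smul_left (inv_pos.2 (norm_pos_iff.2 h0))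
    exact (h1.eq_of_norm_eq (by rw [ℓ.norm_dir, (orientedTangent Φ φ).norm_dir])).symm
  refine OrientedLine.ext ?_ hdir
  rw [ℓ.line_eq_of_mem hy, (orientedTangent Φ φ).line_eq_of_mem hy', hdir]

/-! ### The two tangents through a point, and the reflected line -/

/-- The polarization of `causticForm`. -/
def causticPolar (a b : ℝ) (p v w : ℝ × ℝ) : ℝ :=
  a ^ 2 * (v.2 * w.2) + b ^ 2 * (v.1 * w.1)
    - (p.1 * v.2 - p.2 * v.1) * (p.1 * w.2 - p.2 * w.1)

/-- The determinant of two vectors. -/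
def planeDet (v w : ℝ × ℝ) : ℝ := v.1 * w.2 - v.2 * w.1

/-- Evaluation of the form on `planeDet v v' • w = planeDet w v' • v + planeDet v w • v'`. -/
theorem causticForm_mul_det_sq (a b : ℝ) (p v v' w : ℝ × ℝ) :
    causticForm a b p w * planeDet v v' ^ 2 = planeDet w v' ^ 2 * causticForm a b p v +
      planeDet v w ^ 2 * causticForm a b p v' +
      2 * (planeDet w v' * planeDet v w) * causticPolar a b p v v' := by
  simp only [causticForm, causticPolar, planeDet]; ring

/-- Two independent zeros of `causticForm` span all its zeros. -/
theorem exists_smul_of_causticForm_eq_zero {a b : ℝ} (ha : a ≠ 0) (hb : b ≠ 0) {p v v' w : ℝ × ℝ}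
    (hp : p ≠ 0) (hv : causticForm a b p v = 0) (hv' : causticForm a b p v' = 0)
    (hw : causticForm a b p w = 0) (hd : planeDet v v' ≠ 0) (hpar : ∀ μ : ℝ, w ≠ μ • v) :
    ∃ μ : ℝ, w = μ • v' := by
  have hpp : 0 < causticForm a b p p := by
    have : causticForm a b p p = a ^ 2 * p.2 ^ 2 + b ^ 2 * p.1 ^ 2 := by
      simp only [causticForm]; ring
    rw [this]
    rcases eq_or_ne p.1 0 with h0 | h0
    · have : p.2 ≠ 0 := fun h1 => hp (Prod.ext h0 h1)
      positivity
    · positivity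
  -- With a vanishing polar term the form would be zero in every direction, but it is positive in
  -- the direction `p`.
  have hB : causticPolar a b p v v' ≠ 0 := by
    intro h0
    have := causticForm_mul_det_sq a b p v v' p
    rw [hv, hv', h0] at this
    have h1 : 0 < causticForm a b p p * planeDet v v' ^ 2 := by positivity
    linarith
  have h1 := causticForm_mul_det_sq a b p v v' w
  rw [hv, hv', hw] at h1
  have h2 : planeDet w v' * planeDet v w = 0 := by
    apply mul_right_cancel₀ hB
    linarith
  have hexp : planeDet v v' • w = planeDet w v' • v + planeDet v w • v' := by
    ext <;> simp only [planeDet, Prod.smul_fst, Prod.smul_snd, Prod.fst_add, Prod.snd_add,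
      smul_eq_mul] <;> ring
  rcases mul_eq_zero.1 h2 with h3 | h3
  · refine ⟨(planeDet v v')⁻¹ * planeDet v w, ?_⟩
    rw [h3, zero_smul, zero_add] at hexp
    rw [mul_smul, ← hexp, smul_smul, inv_mul_cancel₀ hd, one_smul]
  · exfalso
    rw [h3, zero_smul, add_zero] at hexp
    apply hpar ((planeDet v v')⁻¹ * planeDet w v')
    rw [mul_smul, ← hexp, smul_smul, inv_mul_cancel₀ hd, one_smul]

namespace IsNested

variable {a b A B : ℝ}

/-- The tangent to the outer ellipse at `ψ` is `B cos ψ x + A sin ψ y = A B`, and the inner ellipse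
lies strictly on its inner side. The bound is Cauchy–Schwarz. -/
theorem inner_normal_lt (h : IsNested a b A B) (φ ψ : ℝ) :
    B * cos ψ * (a * cos φ) + A * sin ψ * (b * sin φ) < A * B := by
  have hA := h.A_pos
  have hB := h.B_pos
  have h1 := sin_sq_add_cos_sq φ
  have h2 := sin_sq_add_cos_sq ψ
  have hb : b ^ 2 < B ^ 2 := by linarith [h.confocal, h.diff_pos]
  have ha : a ^ 2 < A ^ 2 := by linarith [h.diff_pos]
  have hlt : B ^ 2 * (a * cos φ) ^ 2 + A ^ 2 * (b * sin φ) ^ 2 < (A * B) ^ 2 := by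
    have h3 := combination_pos (mul_pos (pow_pos hA 2) (sub_pos.2 hb))
      (mul_pos (pow_pos hB 2) (sub_pos.2 ha)) φ
    have h4 : (A * B) ^ 2 = A ^ 2 * B ^ 2 * (sin φ ^ 2 + cos φ ^ 2) := by rw [h1]; ring
    rw [h4]; linarith
  apply lt_of_pow_lt_pow_left₀ 2 (by positivity)
  refine lt_of_le_of_lt ?_ hlt
  have h5 : B ^ 2 * (a * cos φ) ^ 2 + A ^ 2 * (b * sin φ) ^ 2 =
      (B ^ 2 * (a * cos φ) ^ 2 + A ^ 2 * (b * sin φ) ^ 2) * (sin ψ ^ 2 + cos ψ ^ 2) := by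
    rw [h2, mul_one]
  rw [h5]
  nlinarith [sq_nonneg (B * (a * cos φ) * sin ψ - A * (b * sin φ) * cos ψ)]

/-- The optical property: the tangent line at `φ` is reflected at the point where it leaves the
outer ellipse into the tangent line at `q.next φ`. -/
theorem mirror_tangent (h : IsNested a b A B) {q : Conic} (hq : q.Surrounds) {φ ψ : ℝ}
    (h1 : a * (tangentPoint φ (q.exitTime φ)).1 = A * cos ψ)
    (h2 : b * (tangentPoint φ (q.exitTime φ)).2 = B * sin ψ) :
    ∃ μ : ℝ, 0 < μ ∧ mirror (-(A * sin ψ), B * cos ψ) (a * -sin φ, b * cos φ) =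
      μ • (a * -sin (q.next φ), b * cos (q.next φ)) := by
  have ha := h.a_pos.ne'
  have hb := h.b_ne
  have hτ := hq.exitTime_pos φ
  set τ := q.exitTime φ with hτd
  set v : ℝ × ℝ := (a * -sin φ, b * cos φ) with hvd
  set w := mirror (-(A * sin ψ), B * cos ψ) v with hwd
  have hframe : ∀ χ r,
      (A * cos ψ, B * sin ψ) = (a * (tangentPoint χ r).1, b * (tangentPoint χ r).2) →
      causticForm a b (A * cos ψ, B * sin ψ) (a * -sin χ, b * cos χ) = 0 := by
    intro χ r hr
    rw [hr]
    have hcs := sin_sq_add_cos_sq χ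
    simp only [causticForm, tangentPoint]
    linear_combination (-a ^ 2 * b ^ 2 * (sin χ ^ 2 + cos χ ^ 2)) * hcs
  have hY : ((A * cos ψ, B * sin ψ) : ℝ × ℝ) =
      (a * (tangentPoint φ τ).1, b * (tangentPoint φ τ).2) := by rw [h1, h2]
  have hY' : ((A * cos ψ, B * sin ψ) : ℝ × ℝ) =
      (a * (tangentPoint (q.next φ) (-τ)).1, b * (tangentPoint (q.next φ) (-τ)).2) := by
    rw [hY, hτd, q.tangentPoint_next]
  have hv0 : v ≠ 0 := by
    intro h0
    apply direction_ne_zero φ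
    have e1 : a * -sin φ = 0 := congrArg Prod.fst h0
    have e2 : b * cos φ = 0 := congrArg Prod.snd h0
    exact Prod.ext ((mul_eq_zero.1 e1).resolve_left ha) ((mul_eq_zero.1 e2).resolve_left hb)
  have hNv := hframe φ τ hY
  have hNv' := hframe (q.next φ) (-τ) hY'
  have hNw : causticForm a b (A * cos ψ, B * sin ψ) w = 0 := by
    rw [hwd, h.causticForm_mirror]; exact hNv
  have hpar := h.mirror_ne_smul ψ hv0 hNv
  rw [← hwd] at hpar
  have e1 : A * cos ψ - τ * (a * -sin φ) = a * cos φ := by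
    have := congrArg Prod.fst hY; simp only [tangentPoint] at this; linarith
  have e2 : B * sin ψ - τ * (b * cos φ) = b * sin φ := by
    have := congrArg Prod.snd hY; simp only [tangentPoint] at this; linarith
  have e1' : A * cos ψ + τ * (a * -sin (q.next φ)) = a * cos (q.next φ) := by
    have := congrArg Prod.fst hY'; simp only [tangentPoint] at this; linarith
  have e2' : B * sin ψ + τ * (b * cos (q.next φ)) = b * sin (q.next φ) := by
    have := congrArg Prod.snd hY'; simp only [tangentPoint] at this; linarith
  set v' : ℝ × ℝ := (a * -sin (q.next φ), b * cos (q.next φ)) with hvd'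
  have hcs := sin_sq_add_cos_sq ψ
  -- The direction `v` leads from the inner point of contact to the exit point, so it points
  -- outwards; `v'` leads from there to the next point of contact, so it points inwards. As the
  -- mirror image of `v` also points inwards, `μ` is positive.
  have hs1 : 0 < B * cos ψ * v.1 + A * sin ψ * v.2 := by
    have h3 := h.inner_normal_lt φ ψ
    rw [← e1, ← e2] at h3
    have h4 : 0 < τ * (B * cos ψ * v.1 + A * sin ψ * v.2) := by
      simp only [hvd]
      have : A * B = A * B * (sin ψ ^ 2 + cos ψ ^ 2) := by rw [hcs, mul_one]
      rw [this] at h3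
      linarith
    exact pos_of_mul_pos_right h4 hτ.le
  have hs2 : B * cos ψ * v'.1 + A * sin ψ * v'.2 < 0 := by
    have h3 := h.inner_normal_lt (q.next φ) ψ
    rw [← e1', ← e2'] at h3
    have h4 : 0 < τ * -(B * cos ψ * v'.1 + A * sin ψ * v'.2) := by
      simp only [hvd']
      have : A * B = A * B * (sin ψ ^ 2 + cos ψ ^ 2) := by rw [hcs, mul_one]
      rw [this] at h3
      linarith
    linarith [pos_of_mul_pos_right h4 hτ.le]
  have hs3 : B * cos ψ * w.1 + A * sin ψ * w.2 = -(B * cos ψ * v.1 + A * sin ψ * v.2) := by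
    simp only [hwd, mirror, Prod.fst_sub, Prod.snd_sub, Prod.smul_fst, Prod.smul_snd, smul_eq_mul]
    ring
  have key : ∃ μ : ℝ, w = μ • v' := by
    refine exists_smul_of_causticForm_eq_zero ha hb ?_ hNv hNv' hNw ?_ hpar
    · intro h0
      have f1 : A * cos ψ = 0 := congrArg Prod.fst h0
      have f2 : B * sin ψ = 0 := congrArg Prod.snd h0
      rw [(mul_eq_zero.1 f1).resolve_left h.A_pos.ne',
        (mul_eq_zero.1 f2).resolve_left h.B_pos.ne'] at hcs
      norm_num at hcs
    -- The determinant is `a b sin (next φ - φ) = 2 a b τ / (1 + τ²)`, which is nonzero.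
    · intro h0
      simp only [planeDet, hvd'] at h0
      have h3 : (a * b) * (2 * τ) = 0 := by
        linear_combination (1 + τ ^ 2) * h0 + a * b * sin φ * q.cos_next φ
          - a * b * cos φ * q.sin_next φ - 2 * a * b * τ * sin_sq_add_cos_sq φ
      have : a * b ≠ 0 := mul_ne_zero ha hb
      rcases mul_eq_zero.1 h3 with h4 | h4
      · exact this h4
      · linarith
  obtain ⟨μ, hμ⟩ := key
  refine ⟨μ, ?_, hμ⟩
  rw [hμ] at hs3
  simp only [Prod.smul_fst, Prod.smul_snd, smul_eq_mul] at hs3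
  have : μ * (B * cos ψ * v'.1 + A * sin ψ * v'.2) < 0 := by linarith
  by_contra hle
  have := mul_nonneg_of_nonpos_of_nonpos (not_lt.1 hle) hs2.le
  linarith

end IsNested

theorem mem_ellipse_iff_confocalConic {C : Plane} {ω c a b A B : ℝ} (h : IsNested a b A B)
    (hab : b ^ 2 = a ^ 2 - c ^ 2) (hAB : B ^ 2 = A ^ 2 - c ^ 2) {E : Set Plane}
    (hE : IsUnitChart (frame C ω h.A_pos.ne' h.B_pos.ne') E) (z : ℝ × ℝ) :
    frame C ω h.a_pos.ne' h.b_ne z ∈ E ↔ (confocalConic c a A).eval z.1 z.2 = 0 := by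
  have hA := h.A_pos.ne'
  have hB := h.B_pos.ne'
  have h1 : frame C ω h.a_pos.ne' h.b_ne z = frame C ω hA hB (a * z.1 / A, b * z.2 / B) := by
    rw [frame_apply, frame_apply]; congr 2; ext <;> simp <;> field_simp
  rw [h1, hE, ← sub_eq_zero]
  simp only [confocalConic, Conic.eval, ← hab, ← hAB, div_pow, mul_pow]
  ring_nf

/-- The billiard in the outer ellipse on the oriented tangent lines of the inner one. -/
theorem billiardStep_orientedTangent_iff {C : Plane} {ω c a b A B : ℝ} (hc : 0 ≤ c) (hca : c < a)
    (h : IsNested a b A B) (hab : b ^ 2 = a ^ 2 - c ^ 2) (hAB : B ^ 2 = A ^ 2 - c ^ 2)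
    {E : Set Plane} (hE : IsUnitChart (frame C ω h.A_pos.ne' h.B_pos.ne') E) (φ : ℝ)
    (ℓ : OrientedLine) :
    BilliardStep E (orientedTangent (frame C ω h.a_pos.ne' h.b_ne) φ) ℓ ↔
      ℓ = orientedTangent (frame C ω h.a_pos.ne' h.b_ne) ((confocalConic c a A).next φ) := by
  set Φ := frame C ω h.a_pos.ne' h.b_ne with hΦ
  set q := confocalConic c a A with hqd
  have hq : q.Surrounds := surrounds_confocalConic hc hca h.lt
  have hmem := mem_ellipse_iff_confocalConic (ω := ω) (C := C) h hab hAB hE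
  rw [← hΦ, ← hqd] at hmem
  have hτ := hq.exitTime_pos φ
  set v := Φ.linear (-sin φ, cos φ) with hv
  have hv0 : v ≠ 0 := chart_linear_ne_zero Φ (direction_ne_zero φ)
  have hnv : 0 < ‖v‖ := norm_pos_iff.2 hv0
  have hdir : (orientedTangent Φ φ).dir = ‖v‖⁻¹ • v := rfl
  have hmove : ∀ r r' : ℝ, Φ (tangentPoint φ r) + r' • (orientedTangent Φ φ).dir =
      Φ (tangentPoint φ (r + r' * ‖v‖⁻¹)) := fun r r' => by
    rw [hdir, tangentPoint_eq, tangentPoint_eq, chart_add_smul, chart_add_smul, add_smul,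
      mul_smul, add_assoc]
  have hroot : ∀ r, Φ (tangentPoint φ r) ∈ E ↔
      q.quadCoeff φ * r ^ 2 + 2 * q.linCoeff φ * r + q.constCoeff φ = 0 := fun r => by
    rw [hmem, ← q.eval_tangent]; rfl
  have hexitE : Φ (tangentPoint φ (q.exitTime φ)) ∈ E := (hroot _).2 (hq.exitTime_eq_zero φ)
  have hexit' : Φ (tangentPoint φ (q.exitTime φ)) ∈ chartTangent Φ (q.next φ) :=
    mem_chartTangent.2 ⟨-q.exitTime φ, by rw [q.tangentPoint_next]⟩
  have hvrot : v = rotLin ω (a * -sin φ, b * cos φ) := rfl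
  have hmirror : ∀ ψ, Φ (tangentPoint φ (q.exitTime φ)) = rotLin ω (A * cos ψ, B * sin ψ) + C →
      ∃ μ : ℝ, 0 < μ ∧ rotLin ω (mirror (-(A * sin ψ), B * cos ψ) (a * -sin φ, b * cos φ)) =
        μ • Φ.linear (-sin (q.next φ), cos (q.next φ)) := fun ψ hψ => by
    rw [hΦ, frame_apply] at hψ
    have h1 := (rotLin ω).injective (add_right_cancel hψ)
    obtain ⟨μ, hμ, he⟩ := h.mirror_tangent hq (congrArg Prod.fst h1) (congrArg Prod.snd h1)
    refine ⟨μ, hμ, ?_⟩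
    rw [he, map_smul]; rfl
  constructor
  · rintro ⟨y, hyE, hyL, hlast, hyL', hr⟩
    obtain ⟨r, rfl⟩ := mem_chartTangent.1 hyL
    have hr0 := (hroot r).1 hyE
    have hrτ : r = q.exitTime φ := by
      refine hq.exitTime_unique φ (lt_of_le_of_ne (not_lt.1 fun hneg => ?_)
        (hq.root_ne_zero φ hr0).symm) hr0
      -- A negative root is not the last point on the ellipse, since the exit point comes later.
      apply hlast ((q.exitTime φ - r) * ‖v‖) (mul_pos (by linarith) hnv)
      rw [hmove, mul_assoc, mul_inv_cancel₀ hnv.ne', mul_one, add_sub_cancel]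
      exact hexitE
    subst hrτ
    rw [hdir, hvrot, ← map_smul] at hr
    obtain ⟨ψ, hy, hs⟩ := hr.exists_mirror hE
    obtain ⟨μ, hμ, he⟩ := hmirror ψ hy
    refine OrientedLine.eq_orientedTangent hyL' hexit' ?_
    have hms : mirror (-(A * sin ψ), B * cos ψ) (‖v‖⁻¹ • (a * -sin φ, b * cos φ)) =
        ‖v‖⁻¹ • mirror (-(A * sin ψ), B * cos ψ) (a * -sin φ, b * cos φ) := by
      ext <;> simp only [mirror, Prod.fst_sub, Prod.snd_sub, Prod.smul_fst, Prod.smul_snd,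
        smul_eq_mul] <;> ring
    rw [← hvrot, hms, map_smul, he, smul_smul] at hs
    have hk : 0 < ‖v‖⁻¹ * μ := by positivity
    have hs' := hs.pos_smul_left (inv_pos.2 hk)
    rwa [smul_smul, inv_mul_cancel₀ hk.ne', one_smul] at hs'
  · rintro rfl
    obtain ⟨⟨z1, z2⟩, hz⟩ := (frame C ω h.A_pos.ne' h.B_pos.ne').surjective
      (Φ (tangentPoint φ (q.exitTime φ)))
    obtain ⟨ψ, rfl, rfl⟩ := exists_angle ((hE (z1, z2)).1 (hz ▸ hexitE))
    obtain ⟨μ, hμ, he⟩ := hmirror ψ hz.symm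
    refine ⟨Φ (tangentPoint φ (q.exitTime φ)), hexitE, mem_chartTangent.2 ⟨_, rfl⟩,
      fun r hr hrE => ?_, hexit',
      chartTangent (frame C ω h.A_pos.ne' h.B_pos.ne') ψ, ?_, ?_⟩
    · rw [hmove, hroot] at hrE
      have hpos : 0 < r * ‖v‖⁻¹ := by positivity
      have := hq.exitTime_unique φ (by positivity) hrE
      linarith
    · rw [← hz]; exact isTangentAt_chartTangent hE ψ
    · have hrefl := reflection_rotLin ω (-(A * sin ψ), B * cos ψ) (a * -sin φ, b * cos φ)
        (K := (chartTangent (frame C ω h.A_pos.ne' h.B_pos.ne') ψ).direction) (by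
          rw [chartTangent, AffineSubspace.direction_mk', frame_linear]; simp)
      rw [hdir, map_smul, hvrot, hrefl, he]
      exact (((SameRay.refl _).pos_smul_left hμ).pos_smul_left (inv_pos.2 hnv)).pos_smul_right
        (inv_pos.2 (norm_pos_iff.2 (chart_linear_ne_zero Φ (direction_ne_zero _))))

/-- The billiard step from a tangent line has exactly one outcome, so the choice in `billiardMap` is
forced. The sign of `b`, hence the orientation, is free. -/
theorem FocalFrame.billiardMap_orientedTangent {F₁ F₂ C : Plane} {ω c : ℝ}
    (hF : FocalFrame F₁ F₂ C ω c) {a b : ℝ} (ha : a ≠ 0) (hb : b ≠ 0) (hca : c < a)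
    (hab : b ^ 2 = a ^ 2 - c ^ 2) {s : ℝ} (hs : 2 * a < s) (φ : ℝ) :
    billiardMap (ellipse F₁ F₂ s) (orientedTangent (frame C ω ha hb) φ) =
      orientedTangent (frame C ω ha hb) ((confocalConic c a (s / 2)).next φ) := by
  have hcs : c < s / 2 := by linarith
  obtain ⟨B, hB, hB'⟩ := exists_minor hF.nonneg hcs
  have hN := hF.isNested hca hb hab hB hB' (by linarith)
  have hE := hF.isUnitChart hN.A_pos.ne' hN.B_pos.ne' hcs hB' (s := s) (by ring)
  have hiff := billiardStep_orientedTangent_iff hF.nonneg hca hN hab hB' hE φ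
  have hex : ∃ ℓ', BilliardStep (ellipse F₁ F₂ s) (orientedTangent (frame C ω ha hb) φ) ℓ' :=
    ⟨_, (hiff _).2 rfl⟩
  rw [billiardMap, dif_pos hex]
  exact (hiff _).1 hex.choose_spec

/-! ### Compositions of billiard maps -/

/-- The composition of the billiard ball maps, on the angles of the points of contact. -/
def angleComposition (c a : ℝ) (l : List ℝ) (f : ℝ → ℝ) : ℝ → ℝ :=
  l.foldl (fun f r => (confocalConic c a (r / 2)).next ∘ f) f

theorem isTranslationFor_angleComposition {c a : ℝ} (hc : 0 ≤ c) (hca : c < a) {l : List ℝ}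
    (hl : ∀ r ∈ l, 2 * a < r) {f : ℝ → ℝ} (hf : IsTranslationFor (confocalDensity c a) f) :
    IsTranslationFor (confocalDensity c a) (angleComposition c a l f) := by
  induction l generalizing f with
  | nil => exact hf
  | cons r l ih =>
    have hr := hl r (by simp)
    exact ih (fun r' hr' => hl r' (by simp [hr']))
      ((isTranslationFor_confocalConic hc hca (by linarith)).comp hf)

theorem FocalFrame.foldl_orientedTangent {F₁ F₂ C : Plane} {ω c : ℝ}
    (hF : FocalFrame F₁ F₂ C ω c) {a b : ℝ} (ha : a ≠ 0) (hb : b ≠ 0) (hca : c < a)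
    (hab : b ^ 2 = a ^ 2 - c ^ 2) {l : List ℝ} (hl : ∀ r ∈ l, 2 * a < r)
    {g : OrientedLine → OrientedLine} {f : ℝ → ℝ}
    (hg : ∀ φ, g (orientedTangent (frame C ω ha hb) φ) = orientedTangent (frame C ω ha hb) (f φ))
    (φ : ℝ) :
    l.foldl (fun f r => billiardMap (ellipse F₁ F₂ r) ∘ f) g
        (orientedTangent (frame C ω ha hb) φ) =
      orientedTangent (frame C ω ha hb) (angleComposition c a l f φ) := by
  induction l generalizing f g with
  | nil => exact hg φ
  | cons r l ih =>
    refine ih (fun r' hr' => hl r' (by simp [hr'])) (fun φ => ?_)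
    simp only [Function.comp_apply]
    rw [hg, hF.billiardMap_orientedTangent ha hb hca hab (hl r (by simp))]

theorem FocalFrame.iterate_orientedTangent {F₁ F₂ C : Plane} {ω c : ℝ}
    (hF : FocalFrame F₁ F₂ C ω c) {a b : ℝ} (ha : a ≠ 0) (hb : b ≠ 0) (hca : c < a)
    (hab : b ^ 2 = a ^ 2 - c ^ 2) {k : ℕ} {s : Fin k → ℝ} (hs : ∀ j, 2 * a < s j) (n : ℕ)
    (φ : ℝ) :
    (billiardComposition F₁ F₂ s)^[n] (orientedTangent (frame C ω ha hb) φ) =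
      orientedTangent (frame C ω ha hb) ((angleComposition c a (List.ofFn s) id)^[n] φ) := by
  have hl : ∀ r ∈ List.ofFn s, 2 * a < r := by
    intro r hr
    obtain ⟨j, rfl⟩ := (List.mem_ofFn' _ _).1 hr
    exact hs j
  induction n with
  | zero => rfl
  | succ n ih =>
    rw [Function.iterate_succ_apply', ih, Function.iterate_succ_apply']
    exact hF.foldl_orientedTangent ha hb hca hab hl (fun _ => rfl) _

/-- An oriented tangent line runs in the direction of increasing angles in one of two mirrored
charts. -/
theorem OrientedLine.exists_orientedTangent {C : Plane} {ω a b : ℝ} (ha : a ≠ 0) (hb : b ≠ 0)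
    {E : Set Plane} (hE : IsUnitChart (frame C ω ha hb) E) {ℓ : OrientedLine}
    (h : IsTangent E ℓ.line) :
    ∃ φ, ℓ = orientedTangent (frame C ω ha hb) φ ∨
      ℓ = orientedTangent (frame C ω ha (neg_ne_zero.2 hb)) φ := by
  obtain ⟨φ, hφ⟩ := h.exists_angle hE
  set Φ := frame C ω ha hb with hΦ
  have hy : Φ (cos φ, sin φ) ∈ chartTangent Φ φ := AffineSubspace.self_mem_mk' _ _
  have hyℓ : Φ (cos φ, sin φ) ∈ ℓ.line := by rw [hφ]; exact hy
  have hdir : ℓ.dir ∈ Submodule.span ℝ {Φ.linear (-sin φ, cos φ)} := by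
    have h1 := congrArg AffineSubspace.direction (ℓ.line_eq_of_mem hyℓ)
    rw [hφ, chartTangent, AffineSubspace.direction_mk', AffineSubspace.direction_mk'] at h1
    rw [h1]; exact Submodule.mem_span_singleton_self _
  obtain ⟨r, hr⟩ := Submodule.mem_span_singleton.1 hdir
  rcases le_total 0 r with h0 | h0
  · refine ⟨φ, Or.inl (OrientedLine.eq_orientedTangent hyℓ hy ?_)⟩
    rw [← hr]; exact SameRay.sameRay_nonneg_smul_right _ h0
  · set Φ' := frame C ω ha (neg_ne_zero.2 hb)
    have h1 : Φ (cos φ, sin φ) = Φ' (cos (-φ), sin (-φ)) := by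
      simp only [Φ, Φ', frame_apply]; simp
    have h2 : Φ'.linear (-sin (-φ), cos (-φ)) = -Φ.linear (-sin φ, cos φ) := by
      simp only [Φ, Φ', frame_linear, ← map_neg]; simp
    refine ⟨-φ, Or.inr (OrientedLine.eq_orientedTangent hyℓ ?_ ?_)⟩
    · rw [h1]; exact AffineSubspace.self_mem_mk' _ _
    · rw [h2, ← hr, ← neg_smul_neg]
      exact SameRay.sameRay_nonneg_smul_right _ (neg_nonneg.2 h0)

theorem billiardComposition_porism {F₁ F₂ : Plane} {t : ℝ} {k : ℕ} {s : Fin k → ℝ}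
    (ht : dist F₁ F₂ < t) (hs : ∀ j, t < s j) {n : ℕ} {ℓ : OrientedLine}
    (hℓ : IsTangent (ellipse F₁ F₂ t) ℓ.line)
    (hn : Function.IsPeriodicPt (billiardComposition F₁ F₂ s) n ℓ) {ℓ' : OrientedLine}
    (hℓ' : IsTangent (ellipse F₁ F₂ t) ℓ'.line) :
    Function.IsPeriodicPt (billiardComposition F₁ F₂ s) n ℓ' := by
  obtain ⟨C, ω, c, hF⟩ := exists_focalFrame F₁ F₂
  rw [hF.dist_eq] at ht
  have hc := hF.nonneg
  have hca : c < t / 2 := by linarith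
  have ha : t / 2 ≠ 0 := by linarith
  obtain ⟨b, hb, hb'⟩ := exists_minor hc hca
  have hD := hF.isUnitChart ha hb.ne' hca hb' (s := t) (by ring)
  have hbn : (-b) ^ 2 = (t / 2) ^ 2 - c ^ 2 := by rw [neg_sq, hb']
  have hD' := hF.isUnitChart ha (neg_ne_zero.2 hb.ne') hca hbn (s := t) (by ring)
  have hs' : ∀ j, 2 * (t / 2) < s j := fun j => by have := hs j; linarith
  set F := angleComposition c (t / 2) (List.ofFn s) id with hFd
  have htr : IsTranslationFor (confocalDensity c (t / 2)) F^[n] := by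
    refine (isTranslationFor_angleComposition hc hca (fun r hr => ?_)
      (IsTranslationFor.id _)).iterate n
    obtain ⟨j, rfl⟩ := (List.mem_ofFn' _ _).1 hr
    exact hs' j
  have hit := hF.iterate_orientedTangent ha hb.ne' hca hb' hs' n
  have hit' := hF.iterate_orientedTangent ha (neg_ne_zero.2 hb.ne') hca hbn hs' n
  -- Both orientations give the same map `F`, because `confocalConic` involves no sign of `b`. A
  -- fixed angle found in one chart therefore serves lines of either orientation.
  have hfix : ∃ φ₀, SameAngle (F^[n] φ₀) φ₀ := by
    obtain ⟨φ, h | h⟩ := OrientedLine.exists_orientedTangent ha hb.ne' hD hℓ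
    · refine ⟨φ, sameAngle_of_orientedTangent_eq hD ?_⟩
      rw [← hit, ← h]; exact hn
    · refine ⟨φ, sameAngle_of_orientedTangent_eq hD' ?_⟩
      rw [← hit', ← h]; exact hn
  obtain ⟨φ₀, hφ₀⟩ := hfix
  have hall := htr.sameAngle (continuous_confocalDensity c (t / 2)) (confocalDensity_pos hc hca)
    (fun _ _ h => by simp only [confocalDensity, h.1, h.2]) hφ₀
  obtain ⟨φ, rfl | rfl⟩ := OrientedLine.exists_orientedTangent ha hb.ne' hD hℓ'
  · exact (hit φ).trans (orientedTangent_congr _ (hall φ))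
  · exact (hit' φ).trans (orientedTangent_congr _ (hall φ))

end

theorem corollary6 :
    -- one confocal ellipse as table
    (∀ (F₁ F₂ : Plane) (s t : ℝ), dist F₁ F₂ < s → dist F₁ F₂ < t →
      ∀ (n : ℕ) (x : ℕ → Plane), IsBilliardTrajectory (ellipse F₁ F₂ s) x →
        IsTangentTrajectory (ellipse F₁ F₂ t) x → Function.Periodic x n →
        ∀ y : ℕ → Plane, IsBilliardTrajectory (ellipse F₁ F₂ s) y →
          IsTangentTrajectory (ellipse F₁ F₂ t) y → Function.Periodic y n) ∧
    -- several confocal ellipses around the caustic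
    (∀ (F₁ F₂ : Plane) (t : ℝ) (k : ℕ) (s : Fin k → ℝ), dist F₁ F₂ < t → (∀ j, t < s j) →
      ∀ (n : ℕ) (ℓ : OrientedLine), IsTangent (ellipse F₁ F₂ t) ℓ.line →
        Function.IsPeriodicPt (billiardComposition F₁ F₂ s) n ℓ →
        ∀ ℓ' : OrientedLine, IsTangent (ellipse F₁ F₂ t) ℓ'.line →
          Function.IsPeriodicPt (billiardComposition F₁ F₂ s) n ℓ') ∧
    -- the Poncelet porism for two nested ellipses
    (∀ (F₁ F₂ G₁ G₂ : Plane) (s t : ℝ), dist F₁ F₂ < s → dist G₁ G₂ < t →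
      ellipse G₁ G₂ t ⊆ ellipseInterior F₁ F₂ s →
      ∀ (n : ℕ) (x : ℕ → Plane),
        IsPonceletLine (ellipse F₁ F₂ s) (ellipse G₁ G₂ t) x → x n = x 0 →
        ∀ y : ℕ → Plane,
          IsPonceletLine (ellipse F₁ F₂ s) (ellipse G₁ G₂ t) y → Function.Periodic y n) := by
  refine ⟨?_, ?_, ?_⟩
  · exact fun F₁ F₂ s t hs ht n x hx hxt hn y hy hyt => billiard_porism hs ht hx hxt hn hy hyt
  · exact fun F₁ F₂ t k s ht hs n ℓ hℓ hn ℓ' hℓ' => billiardComposition_porism ht hs hℓ hn hℓ'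
  · exact fun F₁ F₂ G₁ G₂ s t hs ht hin n x hx hn y hy => poncelet_porism hs ht hin hx hn hy
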